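/- A seller with valuation $c$ for one object faces $n\ge 2$ bidders whose private values are iid with an unknown distribution $F$ from a set $\Delta$, where $0\le c<m$ and either (1) $\Delta=\Delta_1(m,\bar v)$ is the set of distributions on $V=[0,\bar v]$ with mean $m$, where $\bar v>m$; or (2) $\Delta=\Delta_2(m,\sigma^2)$ is the set of distributions on $V=[0,\infty)$ with mean $m$ and variance at most $\sigma^2$, where $\sigma\ge 0$. A mechanism $M$ consists of strategy sets $S_1,\dots,S_n$ and of functions giving, for each strategy profile, a (possibly randomized) allocation ($x_i\ge 0$, $\sum_i x_i\le 1$) and a vector of transfers. An outcome $o=(x(\cdot),t(\cdot))$ maps measurably each vector of values to an allocation and a vector of transfers. A solution concept $SC$ assigns to each mechanism $M$ and distribution $F$ a set $SC(M,F)$ of outcomes; only mechanisms with $SC(M,F)\ne\emptyset$ for all $F\in\Delta$ are considered. $M$ is robustly ex post individually rational under $SC$ and $\Delta$ if $v_ix_i(v)-t_i(v)\ge 0$ for all $F\in\Delta$, $(x,t)\in SC(M,F)$, $v\in V^n$ and all $i$. Revenue includes the seller's valuation of the unsold object, and the guarantee of $M$ is $$\underline R_n(M)=\inf_{F\in\Delta}\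 \inf_{(x,t)\in SC(M,F)}\ \mathbb E_{v\sim F^{n}}\Big[\sum_i t_i(v)+c\Big(1-\sum_i x_i(v)\Big)\Big]\in[-\infty,\infty].$$ $SPA(r)$ is the second-price auction with reserve price $r$: the object is sold iff the highest bid exceeds $r$, to a highest bidder (ties broken uniformly), at the maximum of $r$ and the second-highest bid. A maxmin reserve $r^*$ is a maximizer, over $r\ge 0$, of the worst-case (over $F\in\Delta$) expected revenue of $SPA(r)$ when bidders bid their values. Put $$\alpha_n=\frac{n}{n-1}\Big(1-\frac1{(n-1)^2}\Big)^{n-2}-1,\qquad \gamma_n=\alpha_n\sqrt{(n-1)^2\,\phi_n(q_n^*)(1-q_n^*)-1},$$ where $q^*_n=1-\frac1{(n-1)^2}$, $z_n(y)=y^{n-1}-y^{n-2}$ and $\phi_n(q)=\int_q^1(z_n(y)-z_n(q))^2dy\,\Big/\,\Big(\int_q^1(z_n(y)-z_n(q))dy\Big)^2$. Then in each of the two settings: (a) For every $n\ge 2$ and every solution concept, every mechanism that is robustly ex post individually rational satisfies $\underline R_n(M)\le m$. (b) For all sufficiently large $n$, $c$ is a maxmin reserve, and for every maxmin reserve $r^*$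 and every solution concept for which the only outcome of $SPA(r^*)$, at each $F\in\Delta$, is truthful bidding, $\underline R_n(SPA(r^*))=m-\alpha_n(\bar v-m)$ in setting (1) and $\underline R_n(SPA(r^*))=m-\gamma_n\sigma$ in setting (2). (c) For every $\varepsilon>0$ there is $N$ such that for all $n>N$, every maxmin reserve $r^*$, every solution concept for which the only outcome of $SPA(r^*)$, at each $F\in\Delta$, is truthful bidding, and every mechanism $M$ that is robustly ex post individually rational under it, $\underline R_n(SPA(r^*))>\underline R_n(M)-\varepsilon$. Moreover $\alpha_n\to0$, $n^2\alpha_n\to\frac12$ and $\gamma_n\to0$ as $n\to\infty$. -/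

import Mathlib

open MeasureTheory ProbabilityTheory Filter Topology

namespace RobustAuction

noncomputable section

/-- Possibly randomized allocations of one object to `n` bidders:
`x i` is the probability that bidder `i` gets it. -/
def allocations (n : ℕ) : Set (Fin n → ℝ) :=
  {x | (∀ i, 0 ≤ x i) ∧ ∑ i, x i ≤ 1}

/-- A mechanism: strategy sets, and an allocation and a vector of transfers (from the bidders to the
seller) for each strategy profile. -/
structure Mechanism (n : ℕ) where
  Strategy : Fin n → Type
  alloc : (∀ i, Strategy i) → Fin n → ℝ
  pay : (∀ i, Strategy i) → Fin n → ℝ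
  alloc_mem : ∀ s, alloc s ∈ allocations n

/-- A pair of measurable outcome functions: vectors of values are mapped to an allocation and a
vector of transfers. -/
structure Outcome (n : ℕ) where
  alloc : (Fin n → ℝ) → Fin n → ℝ
  pay : (Fin n → ℝ) → Fin n → ℝ
  alloc_mem : ∀ v, alloc v ∈ allocations n
  measurable_alloc : Measurable alloc
  measurable_pay : Measurable pay

/-- A solution concept: a correspondence from mechanisms and value distributions to outcome
functions. -/
abbrev SolutionConcept (n : ℕ) : Type 1 :=
  Mechanism n → ProbabilityMeasure ℝ → Set (Outcome n)

/-- Distributions on `[0, vbar]` with mean `m`. -/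
def meanBoundSet (m vbar : ℝ) : Set (ProbabilityMeasure ℝ) :=
  {F | (∀ᵐ v ∂(F : Measure ℝ), v ∈ Set.Icc 0 vbar) ∧ ∫ v, v ∂(F : Measure ℝ) = m}

/-- Distributions on `[0, ∞)` with mean `m` and variance at most `σ ^ 2`
(`evariance` is the variance as an extended nonnegative number). -/
def meanVarianceSet (m σ : ℝ) : Set (ProbabilityMeasure ℝ) :=
  {F | (∀ᵐ v ∂(F : Measure ℝ), v ∈ Set.Ici 0) ∧
    Integrable (fun v : ℝ => v) (F : Measure ℝ) ∧ ∫ v, v ∂(F : Measure ℝ) = m ∧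
    evariance (fun v : ℝ => v) (F : Measure ℝ) ≤ ENNReal.ofReal (σ ^ 2)}

/-- The seller's revenue at the vector of values `v`, including her valuation `c` of the object,
which she enjoys when she keeps it. -/
def revenue {n : ℕ} (c : ℝ) (o : Outcome n) (v : Fin n → ℝ) : ℝ :=
  ∑ i, o.pay v i + c * (1 - ∑ i, o.alloc v i)

/-- Expected revenue when the values of the `n` bidders are iid with distribution `F`: the integral
of the positive part minus the integral of the negative part, as an extended real number. -/
def expectedRevenue {n : ℕ} (c : ℝ) (F : ProbabilityMeasure ℝ) (o : Outcome n) : EReal :=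
  ((∫⁻ v, ENNReal.ofReal (revenue c o v)
      ∂(Measure.pi fun _ : Fin n => (F : Measure ℝ)) : ENNReal) : EReal) -
    ((∫⁻ v, ENNReal.ofReal (-revenue c o v)
      ∂(Measure.pi fun _ : Fin n => (F : Measure ℝ)) : ENNReal) : EReal)

/-- The revenue guarantee of a mechanism: the worst case over feasible distributions and over the
outcome functions that the solution concept deems possible. -/
def guarantee {n : ℕ} (Δ : Set (ProbabilityMeasure ℝ)) (c : ℝ) (SC : SolutionConcept n)
    (M : Mechanism n) : EReal :=
  ⨅ F ∈ Δ, ⨅ o ∈ SC M F, expectedRevenue c F o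

/-- The seller only considers mechanisms with some possible outcome at every feasible
distribution. -/
def IsAdmissible {n : ℕ} (Δ : Set (ProbabilityMeasure ℝ)) (SC : SolutionConcept n)
    (M : Mechanism n) : Prop :=
  ∀ F ∈ Δ, (SC M F).Nonempty

/-- Robust ex post individual rationality; `V` is the set of possible values of a bidder. -/
def IsRobustlyExPostIR {n : ℕ} (V : Set ℝ) (Δ : Set (ProbabilityMeasure ℝ))
    (SC : SolutionConcept n) (M : Mechanism n) : Prop :=
  ∀ F ∈ Δ, ∀ o ∈ SC M F, ∀ v : Fin n → ℝ, (∀ i, v i ∈ V) →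
    ∀ i, 0 ≤ v i * o.alloc v i - o.pay v i

/-- Second-price auction with reserve `r`: the object is sold iff the highest bid exceeds `r`, to a
bidder chosen uniformly among the highest ones. -/
def spaAlloc {n : ℕ} (r : ℝ) (b : Fin n → ℝ) (i : Fin n) : ℝ :=
  open scoped Classical in
  if r < b i ∧ ∀ j, b j ≤ b i then
    1 / ((Finset.univ.filter fun j => b j = b i).card : ℝ) else 0

/-- The maximum of the reserve and of the bids of the competitors of `i`. -/
def spaPrice {n : ℕ} (r : ℝ) (b : Fin n → ℝ) (i : Fin n) : ℝ :=
  (Finset.univ.erase i).fold max r b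

/-- The winner pays the price; under random tie-breaking this is the expected transfer (the price
is then the common highest bid). -/
def spaPay {n : ℕ} (r : ℝ) (b : Fin n → ℝ) (i : Fin n) : ℝ :=
  spaAlloc r b i * spaPrice r b i

theorem spaAlloc_mem {n : ℕ} (r : ℝ) (b : Fin n → ℝ) : spaAlloc r b ∈ allocations n := by
  classical
  refine ⟨fun i => ?_, ?_⟩
  · unfold spaAlloc; split_ifs <;> positivity
  · by_cases h : ∃ i, r < b i ∧ ∀ j, b j ≤ b i
    · obtain ⟨i, hi, hmax⟩ := h
      have key : ∀ j, spaAlloc r b j =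
          if b j = b i then 1 / ((Finset.univ.filter fun k => b k = b i).card : ℝ) else 0 := by
        intro j
        unfold spaAlloc
        by_cases hj : b j = b i
        · simp only [hj]; rw [if_pos ⟨hi, hmax⟩]; simp
        · rw [if_neg (fun hh => hj (le_antisymm (hmax j) (hh.2 i))), if_neg hj]
      rw [Finset.sum_congr rfl fun j _ => key j, ← Finset.sum_filter, Finset.sum_const,
        nsmul_eq_mul]
      by_cases h0 : ((Finset.univ.filter fun k => b k = b i).card : ℝ) = 0
      · rw [h0]; norm_num
      · rw [mul_one_div_cancel h0]
    · have : ∀ j, spaAlloc r b j = 0 := fun j => if_neg fun hj => h ⟨j, hj⟩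
      simp [this]

theorem measurable_spaAlloc {n : ℕ} (r : ℝ) :
    Measurable (spaAlloc r : (Fin n → ℝ) → Fin n → ℝ) := by
  classical
  refine measurable_pi_lambda _ fun i => ?_
  have hcard : (fun b : Fin n → ℝ => ((Finset.univ.filter fun j => b j = b i).card : ℝ)) =
      fun b => ∑ j, if b j = b i then (1 : ℝ) else 0 := by
    funext b; simp
  have h1 : Measurable fun b : Fin n → ℝ =>
      1 / ((Finset.univ.filter fun j => b j = b i).card : ℝ) := by
    refine Measurable.div measurable_const ?_
    rw [hcard]
    exact Finset.measurable_sum _ fun j _ => Measurable.ite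
      (measurableSet_eq_fun (measurable_pi_apply j) (measurable_pi_apply i))
      measurable_const measurable_const
  have h2 : MeasurableSet {b : Fin n → ℝ | r < b i ∧ ∀ j, b j ≤ b i} := by
    refine (measurableSet_lt measurable_const (measurable_pi_apply i)).inter ?_
    have : {b : Fin n → ℝ | ∀ j, b j ≤ b i} = ⋂ j, {b | b j ≤ b i} := by
      ext; simp
    change MeasurableSet {b : Fin n → ℝ | ∀ j, b j ≤ b i}
    rw [this]
    exact MeasurableSet.iInter fun j =>
      measurableSet_le (measurable_pi_apply j) (measurable_pi_apply i)
  unfold spaAlloc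
  convert Measurable.ite h2 h1 (measurable_const (a := (0 : ℝ))) using 2

theorem measurable_spaPay {n : ℕ} (r : ℝ) :
    Measurable (spaPay r : (Fin n → ℝ) → Fin n → ℝ) := by
  classical
  refine measurable_pi_lambda _ fun i => ?_
  refine Measurable.mul ((measurable_pi_apply i).comp (measurable_spaAlloc r)) ?_
  unfold spaPrice
  induction (Finset.univ.erase i : Finset (Fin n)) using Finset.induction_on with
  | empty => simp
  | insert a s ha ih =>
    simp only [Finset.fold_insert ha]
    exact (measurable_pi_apply a).max ih

/-- The second-price auction with reserve `r` as a mechanism; strategies are bids. -/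
def spa (n : ℕ) (r : ℝ) : Mechanism n where
  Strategy _ := ℝ
  alloc b := spaAlloc r b
  pay b := spaPay r b
  alloc_mem b := spaAlloc_mem r b

/-- The outcome functions of the second-price auction in dominant strategies: every bidder bids
her value. -/
def spaTruthful (n : ℕ) (r : ℝ) : Outcome n where
  alloc v := (spa n r).alloc v
  pay v := (spa n r).pay v
  alloc_mem v := (spa n r).alloc_mem v
  measurable_alloc := measurable_spaAlloc r
  measurable_pay := measurable_spaPay r

/-- The worst-case expected revenue of the second-price auction with reserve `r` and truthful
bidding. -/
def reserveGuarantee (n : ℕ) (Δ : Set (ProbabilityMeasure ℝ)) (c r : ℝ) : EReal :=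
  ⨅ F ∈ Δ, expectedRevenue c F (spaTruthful n r)

/-- A maxmin reserve price: `r ≥ 0` maximizes the worst-case expected revenue of the second-price
auction with truthful bidding. -/
def IsMaxminReserve (n : ℕ) (Δ : Set (ProbabilityMeasure ℝ)) (c r : ℝ) : Prop :=
  0 ≤ r ∧ ∀ r' : ℝ, 0 ≤ r' → reserveGuarantee n Δ c r' ≤ reserveGuarantee n Δ c r

/-- In the second-price auction with reserve `r` the solution concept selects truthful bidding. -/
def SelectsTruthful {n : ℕ} (Δ : Set (ProbabilityMeasure ℝ)) (SC : SolutionConcept n)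
    (r : ℝ) : Prop :=
  ∀ F ∈ Δ, SC (spa n r) F = {spaTruthful n r}

def alpha (n : ℕ) : ℝ :=
  (n : ℝ) / ((n : ℝ) - 1) * (1 - 1 / ((n : ℝ) - 1) ^ 2) ^ (n - 2) - 1

def qStar (n : ℕ) : ℝ := 1 - 1 / ((n : ℝ) - 1) ^ 2

def zFun (n : ℕ) (y : ℝ) : ℝ := y ^ (n - 1) - y ^ (n - 2)

def phi (n : ℕ) (q : ℝ) : ℝ :=
  (∫ y in q..1, (zFun n y - zFun n q) ^ 2) / (∫ y in q..1, (zFun n y - zFun n q)) ^ 2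

def psi (n : ℕ) (q : ℝ) : ℝ := phi n q * (1 - q)

def gamma (n : ℕ) : ℝ :=
  alpha n * Real.sqrt (((n : ℝ) - 1) ^ 2 * psi n (qStar n) - 1)

/-- The claim for one setting, given the set `V` of possible values, the set `Δ` of feasible
distributions, the mean `m`, the seller's valuation `c` and the penalty `π n` of the second-price
auction with `n` bidders: no robustly ex post individually rational mechanism guarantees more than
`m`; for large `n`, maxmin reserves exist (`c` is one) and any of them guarantees exactly `m - π n`;
and the second-price auction with any of them is asymptotically maxmin. -/
def AsymptoticallyMaxmin (V : Set ℝ) (Δ : Set (ProbabilityMeasure ℝ)) (m c : ℝ)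
    (π : ℕ → ℝ) : Prop :=
  (∀ n : ℕ, 2 ≤ n → ∀ (SC : SolutionConcept n) (M : Mechanism n),
      IsAdmissible Δ SC M → IsRobustlyExPostIR V Δ SC M →
        guarantee Δ c SC M ≤ (m : EReal)) ∧
  (∃ N : ℕ, ∀ n : ℕ, N < n → IsMaxminReserve n Δ c c ∧
      ∀ (SC : SolutionConcept n) (r : ℝ), IsMaxminReserve n Δ c r → SelectsTruthful Δ SC r →
        guarantee Δ c SC (spa n r) = ((m - π n : ℝ) : EReal)) ∧
  (∀ ε : ℝ, 0 < ε → ∃ N : ℕ, ∀ n : ℕ, N < n →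
      ∀ (SC : SolutionConcept n) (r : ℝ), IsMaxminReserve n Δ c r → SelectsTruthful Δ SC r →
        ∀ M : Mechanism n, IsAdmissible Δ SC M → IsRobustlyExPostIR V Δ SC M →
          guarantee Δ c SC M - (ε : EReal) < guarantee Δ c SC (spa n r))

end

end RobustAuction

open MeasureTheory ProbabilityTheory Filter Topology

namespace RobustAuction

/-! No mechanism can guarantee more than `m`, because the point mass at `m` is feasible: there ex
post individual rationality caps payments by `m` times the probability of sale, and an unsold object
is worth only `c < m`.

For the auction, let G be the distribution function of the second-highest of `n` uniform draws
(`secondCDF`), so that the expected second-highest value is the integral of 1 - G(F(t)) over t > 0.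
G is convex and then concave. Its concave envelope is the tangent from the origin, of slope `1 +
alpha n`, up to the tangency point `qStar n`, and G itself afterwards. Replacing G by the envelope
and passing to a quantile function Q of F bounds the expectation below by (1 + α)m - ∫ Q · `excess`,
where `excess` is nonnegative and nondecreasing, vanishes up to `qStar n` and has integral α. The
bound is an equality when Q is constant up to `qStar n`, since F then takes no value strictly
between 0 and `qStar n`.

What remains is to maximize a linear functional of Q. With values at most v̄, use Q ≤ v̄; a
two-point law attains the bound. With a variance bound, use Cauchy–Schwarz; `gamma n` is the
standard deviation of `excess`, and equality holds for Q affine in `excess`. Both maximizers are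
constant up to `qStar n`.

With reserve `c`, revenue is at least the second-highest value, so the guarantee is at least m - π.
No reserve does better for large `n`. The least value a_n of the worst-case law tends to `m`. A
reserve below a_n never binds against that law; a reserve in [a_n, m) is defeated by a law with an
atom of mass `qStar n` at the reserve, where revenue is close to `c`; a reserve of at least `m`
never sells at the point mass. `asymptoticallyMaxmin_of_bounds` makes this argument for both
settings at once. -/

/-! ### Second-highest value and revenue of the second-price auction. -/

/-- The second-highest value, truncated below at zero. -/
noncomputable def secondValue {n : ℕ} (v : Fin n → ℝ) : ℝ := ⨅ i, spaPrice 0 v i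

theorem spaPrice_le_iff {n : ℕ} {r t : ℝ} {b : Fin n → ℝ} {i : Fin n} :
    spaPrice r b i ≤ t ↔ r ≤ t ∧ ∀ j, j ≠ i → b j ≤ t := by
  simp [spaPrice, Finset.fold_max_le]

theorem reserve_le_spaPrice {n : ℕ} (r : ℝ) (b : Fin n → ℝ) (i : Fin n) : r ≤ spaPrice r b i :=
  (spaPrice_le_iff.1 le_rfl).1

theorem le_spaPrice {n : ℕ} (r : ℝ) (b : Fin n → ℝ) {i j : Fin n} (h : j ≠ i) :
    b j ≤ spaPrice r b i :=
  (spaPrice_le_iff.1 le_rfl).2 j h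

theorem exists_secondValue_eq {n : ℕ} (hn : 2 ≤ n) (v : Fin n → ℝ) :
    ∃ i, spaPrice 0 v i = secondValue v := by
  have : Nonempty (Fin n) := ⟨⟨0, by omega⟩⟩
  exact exists_eq_ciInf_of_finite

theorem secondValue_le_spaPrice {n : ℕ} (v : Fin n → ℝ) (i : Fin n) :
    secondValue v ≤ spaPrice 0 v i :=
  ciInf_le (Set.finite_range _).bddBelow i

theorem secondValue_le_iff {n : ℕ} (hn : 2 ≤ n) {v : Fin n → ℝ} {t : ℝ} :
    secondValue v ≤ t ↔ 0 ≤ t ∧ ∃ i, ∀ j, j ≠ i → v j ≤ t := by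
  constructor
  · intro h
    obtain ⟨i, hi⟩ := exists_secondValue_eq hn v
    rw [← hi, spaPrice_le_iff] at h
    exact ⟨h.1, i, h.2⟩
  · rintro ⟨h0, i, hi⟩
    exact (secondValue_le_spaPrice v i).trans (spaPrice_le_iff.2 ⟨h0, hi⟩)

theorem secondValue_nonneg {n : ℕ} (hn : 2 ≤ n) (v : Fin n → ℝ) : 0 ≤ secondValue v :=
  ((secondValue_le_iff hn).1 le_rfl).1

theorem le_secondValue {n : ℕ} (hn : 2 ≤ n) {v : Fin n → ℝ} {a : ℝ} (h : ∀ i, a ≤ v i) :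
    a ≤ secondValue v := by
  obtain ⟨-, i, hi⟩ := (secondValue_le_iff hn (v := v)).1 le_rfl
  obtain ⟨j, hj⟩ : ∃ j : Fin n, j ≠ i := by
    have : Nontrivial (Fin n) := Fin.nontrivial_iff_two_le.2 hn
    exact exists_ne i
  exact (h j).trans (hi j hj)

/-- Leaving out a highest bidder attains the infimum that defines `secondValue`, with or without
ties. -/
theorem spaPrice_eq_max {n : ℕ} (hn : 2 ≤ n) {r : ℝ} (hr : 0 ≤ r) {v : Fin n → ℝ} {i : Fin n}
    (hi : ∀ j, v j ≤ v i) : spaPrice r v i = max r (secondValue v) := by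
  apply le_antisymm
  · refine spaPrice_le_iff.2 ⟨le_max_left _ _, fun j hj => le_max_of_le_right ?_⟩
    obtain ⟨k, hk⟩ := exists_secondValue_eq hn v
    rw [← hk]
    by_cases hjk : j = k
    · subst hjk
      exact (hi j).trans (le_spaPrice 0 v hj.symm)
    · exact le_spaPrice 0 v hjk
  · refine max_le (reserve_le_spaPrice r v i) ((secondValue_le_spaPrice v i).trans ?_)
    exact spaPrice_le_iff.2
      ⟨hr.trans (reserve_le_spaPrice r v i), fun j hj => le_spaPrice r v hj⟩

theorem sum_spaAlloc_of_sold {n : ℕ} {r : ℝ} {v : Fin n → ℝ} (h : ∃ i, r < v i) :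
    ∑ i, spaAlloc r v i = 1 := by
  classical
  obtain ⟨i₀, hi₀⟩ := h
  obtain ⟨i, -, hi⟩ := Finset.exists_max_image Finset.univ v ⟨i₀, Finset.mem_univ _⟩
  have hmax : ∀ j, v j ≤ v i := fun j => hi j (Finset.mem_univ _)
  have hri : r < v i := hi₀.trans_le (hmax i₀)
  have key : ∀ j, spaAlloc r v j =
      if v j = v i then 1 / ((Finset.univ.filter fun k => v k = v i).card : ℝ) else 0 := by
    intro j
    unfold spaAlloc
    by_cases hj : v j = v i
    · simp only [hj]; rw [if_pos ⟨hri, hmax⟩]; simp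
    · rw [if_neg (fun hh => hj (le_antisymm (hmax j) (hh.2 i))), if_neg hj]
  rw [Finset.sum_congr rfl fun j _ => key j, ← Finset.sum_filter, Finset.sum_const, nsmul_eq_mul]
  refine mul_one_div_cancel ?_
  have : 0 < (Finset.univ.filter fun k => v k = v i).card :=
    Finset.card_pos.2 ⟨i, by simp⟩
  positivity

theorem spaAlloc_eq_zero_of_unsold {n : ℕ} {r : ℝ} {v : Fin n → ℝ} (h : ¬ ∃ i, r < v i)
    (i : Fin n) : spaAlloc r v i = 0 :=
  if_neg fun hi => h ⟨i, hi.1⟩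

theorem revenue_of_sold {n : ℕ} (hn : 2 ≤ n) (c : ℝ) {r : ℝ} (hr : 0 ≤ r) {v : Fin n → ℝ}
    (h : ∃ i, r < v i) : revenue c (spaTruthful n r) v = max r (secondValue v) := by
  have hpay : ∀ i, spaPay r v i = spaAlloc r v i * max r (secondValue v) := by
    intro i
    by_cases hi : ∀ j, v j ≤ v i
    · rw [spaPay, spaPrice_eq_max hn hr hi]
    · have : spaAlloc r v i = 0 := if_neg fun hh => hi hh.2
      rw [spaPay, this, zero_mul, zero_mul]
  change ∑ i, spaPay r v i + c * (1 - ∑ i, spaAlloc r v i) = _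
  rw [Finset.sum_congr rfl fun i _ => hpay i, ← Finset.sum_mul, sum_spaAlloc_of_sold h]
  ring

theorem revenue_of_unsold {n : ℕ} (c : ℝ) {r : ℝ} {v : Fin n → ℝ} (h : ¬ ∃ i, r < v i) :
    revenue c (spaTruthful n r) v = c := by
  change ∑ i, spaPay r v i + c * (1 - ∑ i, spaAlloc r v i) = _
  simp [spaPay, spaAlloc_eq_zero_of_unsold h]

theorem revenue_nonneg {n : ℕ} (hn : 2 ≤ n) {c r : ℝ} (hc : 0 ≤ c) (hr : 0 ≤ r)
    (v : Fin n → ℝ) : 0 ≤ revenue c (spaTruthful n r) v := by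
  by_cases h : ∃ i, r < v i
  · rw [revenue_of_sold hn c hr h]; exact le_max_of_le_left hr
  · rw [revenue_of_unsold c h]; exact hc

/-- If the object is unsold, all values are at most `c`, which is what the seller then enjoys. This
is the merit of the reserve `c`. -/
theorem secondValue_le_revenue {n : ℕ} (hn : 2 ≤ n) {c : ℝ} (hc : 0 ≤ c) (v : Fin n → ℝ) :
    secondValue v ≤ revenue c (spaTruthful n c) v := by
  by_cases h : ∃ i, c < v i
  · rw [revenue_of_sold hn c hc h]; exact le_max_right _ _
  · rw [revenue_of_unsold c h]
    push Not at h
    exact (secondValue_le_iff hn).2 ⟨hc, ⟨0, by omega⟩, fun j _ => h j⟩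

/-- A reserve below all values never binds. -/
theorem revenue_eq_secondValue {n : ℕ} (hn : 2 ≤ n) (c : ℝ) {r a : ℝ} (hr : 0 ≤ r) (hra : r < a)
    {v : Fin n → ℝ} (hv : ∀ i, a ≤ v i) :
    revenue c (spaTruthful n r) v = secondValue v := by
  rw [revenue_of_sold hn c hr ⟨⟨0, by omega⟩, hra.trans_le (hv _)⟩]
  exact max_eq_right (hra.le.trans (le_secondValue hn hv))

theorem expectedRevenue_spaTruthful {n : ℕ} (hn : 2 ≤ n) {c r : ℝ} (hc : 0 ≤ c) (hr : 0 ≤ r)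
    (F : ProbabilityMeasure ℝ) :
    expectedRevenue c F (spaTruthful n r) =
      ((∫⁻ v, ENNReal.ofReal (revenue c (spaTruthful n r) v)
        ∂(Measure.pi fun _ : Fin n => (F : Measure ℝ)) : ENNReal) : EReal) := by
  have : ∀ v : Fin n → ℝ, ENNReal.ofReal (-revenue c (spaTruthful n r) v) = 0 := fun v =>
    ENNReal.ofReal_eq_zero.2 (neg_nonpos.2 (revenue_nonneg hn hc hr v))
  simp [expectedRevenue, this]

theorem measurable_secondValue {n : ℕ} : Measurable (secondValue : (Fin n → ℝ) → ℝ) := by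
  classical
  refine Measurable.iInf fun i => ?_
  unfold spaPrice
  induction (Finset.univ.erase i : Finset (Fin n)) using Finset.induction_on with
  | empty => simp
  | insert a s ha ih =>
    simp only [Finset.fold_insert ha]
    exact (measurable_pi_apply a).max ih

/-! ### Distribution of the second-highest value. -/

/-- The probability that at most one of `n` independent draws exceeds a threshold that a single
draw does not exceed with probability `p`. -/
noncomputable def secondCDF (n : ℕ) (p : ℝ) : ℝ := n * p ^ (n - 1) - (n - 1) * p ^ n

/-- The event splits disjointly into `A`, where no value exceeds `t`, and the sets `B i`, where
exactly that of `i` does. -/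
theorem real_pi_secondValue_le {n : ℕ} (hn : 2 ≤ n) (F : Measure ℝ) [IsProbabilityMeasure F]
    {t : ℝ} (ht : 0 ≤ t) :
    (Measure.pi fun _ : Fin n => F).real {v | secondValue v ≤ t} =
      secondCDF n (F.real (Set.Iic t)) := by
  classical
  set p := F.real (Set.Iic t) with hp
  have hq : F.real (Set.Ioi t) = 1 - p := by
    rw [← Set.compl_Iic, probReal_compl_eq_one_sub measurableSet_Iic]
  let A : Set (Fin n → ℝ) := Set.univ.pi fun _ => Set.Iic t
  let B : Fin n → Set (Fin n → ℝ) := fun i =>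
    Set.univ.pi fun j => if j = i then Set.Ioi t else Set.Iic t
  have hA : (Measure.pi fun _ : Fin n => F).real A = p ^ n := by
    rw [Measure.real, Measure.pi_pi, ENNReal.toReal_prod, hp]
    simp [Measure.real]
  have hB : ∀ i, (Measure.pi fun _ : Fin n => F).real (B i) = (1 - p) * p ^ (n - 1) := by
    intro i
    rw [Measure.real, Measure.pi_pi, ENNReal.toReal_prod,
      ← Finset.mul_prod_erase _ _ (Finset.mem_univ i)]
    congr 1
    · simpa [Measure.real] using hq
    · rw [Finset.prod_congr rfl (g := fun _ => p)]
      · simp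
      · intro j hj
        rw [if_neg (Finset.ne_of_mem_erase hj)]
        rfl
  have hmeasA : MeasurableSet A := MeasurableSet.univ_pi fun _ => measurableSet_Iic
  have hmeasB : ∀ i, MeasurableSet (B i) := fun i => MeasurableSet.univ_pi fun j => by
    split_ifs
    exacts [measurableSet_Ioi, measurableSet_Iic]
  have hmemB : ∀ v i, v ∈ B i ↔ t < v i ∧ ∀ j, j ≠ i → v j ≤ t := by
    intro v i
    simp only [B, Set.mem_univ_pi]
    constructor
    · intro h
      exact ⟨by simpa using h i, fun j hj => by simpa [hj] using h j⟩
    · rintro ⟨h1, h2⟩ j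
      by_cases hj : j = i
      · subst hj; simpa using h1
      · simpa [hj] using h2 j hj
  have hset : {v : Fin n → ℝ | secondValue v ≤ t} = A ∪ ⋃ i, B i := by
    ext v
    simp only [Set.mem_ofPred_eq, secondValue_le_iff hn, Set.mem_union, Set.mem_iUnion, hmemB]
    constructor
    · rintro ⟨-, i, hi⟩
      by_cases h : v i ≤ t
      · left
        intro j _
        by_cases hj : j = i
        · subst hj; exact h
        · exact hi j hj
      · exact Or.inr ⟨i, not_le.1 h, hi⟩
    · rintro (h | ⟨i, -, hi⟩)
      · exact ⟨ht, ⟨0, by omega⟩, fun j _ => h j (Set.mem_univ j)⟩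
      · exact ⟨ht, i, hi⟩
  have hdisj : Disjoint A (⋃ i, B i) := by
    rw [Set.disjoint_left]
    intro v hv hv'
    obtain ⟨i, hi⟩ := Set.mem_iUnion.1 hv'
    exact absurd (hv i (Set.mem_univ i)) (not_le.2 ((hmemB v i).1 hi).1)
  have hpair : Pairwise (Function.onFun Disjoint B) := by
    intro i j hij
    change Disjoint (B i) (B j)
    rw [Set.disjoint_left]
    intro v hv hv'
    exact absurd (((hmemB v j).1 hv').2 i hij) (not_le.2 ((hmemB v i).1 hv).1)
  rw [hset, measureReal_union hdisj (MeasurableSet.iUnion hmeasB), hA,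
    measureReal_iUnion_fintype hpair hmeasB, Finset.sum_congr rfl fun i _ => hB i, Finset.sum_const,
    Finset.card_univ, Fintype.card_fin, nsmul_eq_mul, secondCDF]
  obtain ⟨k, rfl⟩ : ∃ k, n = k + 1 := ⟨n - 1, by omega⟩
  simp only [Nat.add_sub_cancel, pow_succ]
  push_cast
  ring

theorem lintegral_secondValue {n : ℕ} (hn : 2 ≤ n) (F : Measure ℝ) [IsProbabilityMeasure F] :
    ∫⁻ v, ENNReal.ofReal (secondValue v) ∂(Measure.pi fun _ : Fin n => F) =
      ∫⁻ t in Set.Ioi 0, ENNReal.ofReal (1 - secondCDF n (F.real (Set.Iic t))) := by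
  rw [lintegral_eq_lintegral_meas_lt _ (ae_of_all _ (secondValue_nonneg hn))
    measurable_secondValue.aemeasurable]
  refine setLIntegral_congr_fun measurableSet_Ioi fun t ht => ?_
  have hms : MeasurableSet {v : Fin n → ℝ | secondValue v ≤ t} :=
    measurableSet_le measurable_secondValue measurable_const
  have hc : {v : Fin n → ℝ | t < secondValue v} = {v | secondValue v ≤ t}ᶜ := by
    ext v; simp
  rw [hc, ← real_pi_secondValue_le hn F (le_of_lt ht), ← probReal_compl_eq_one_sub hms,
    ofReal_measureReal]

/-! ### The concave envelope of `secondCDF`. -/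

/-- The density of the second-highest of `n` independent uniform draws. -/
noncomputable def secondDensity (n : ℕ) (u : ℝ) : ℝ := n * (n - 1) * u ^ (n - 2) * (1 - u)

/-- The derivative of the concave envelope of `secondCDF`. -/
noncomputable def envelopeDensity (n : ℕ) (u : ℝ) : ℝ := secondDensity n (max u (qStar n))

/-- The distance of `envelopeDensity` to its maximum. -/
noncomputable def excess (n : ℕ) (u : ℝ) : ℝ := 1 + alpha n - envelopeDensity n u

theorem one_sub_qStar (n : ℕ) : 1 - qStar n = 1 / ((n : ℝ) - 1) ^ 2 := by
  unfold qStar; ring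

theorem qStar_lt_one {n : ℕ} (hn : 2 ≤ n) : qStar n < 1 := by
  have : (2 : ℝ) ≤ n := by exact_mod_cast hn
  have h : 0 < 1 / ((n : ℝ) - 1) ^ 2 := by
    have : (0 : ℝ) < n - 1 := by linarith
    positivity
  unfold qStar; linarith

/-- At `n = 2` the tangency point degenerates to 0, so the estimates start at `n = 3`. -/
theorem qStar_pos {n : ℕ} (hn : 3 ≤ n) : 0 < qStar n := by
  have : (3 : ℝ) ≤ n := by exact_mod_cast hn
  have h1 : (1 : ℝ) < ((n : ℝ) - 1) ^ 2 := by nlinarith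
  have h : 1 / ((n : ℝ) - 1) ^ 2 < 1 := by rw [div_lt_one (by linarith)]; exact h1
  unfold qStar; linarith

theorem qStar_mul {n : ℕ} (hn : 3 ≤ n) :
    ((n : ℝ) - 1) ^ 2 * qStar n = n * (n - 2) := by
  have : (3 : ℝ) ≤ n := by exact_mod_cast hn
  have h0 : ((n : ℝ) - 1) ≠ 0 := by linarith
  unfold qStar; field_simp; ring

theorem one_add_alpha (n : ℕ) : 1 + alpha n = n / (n - 1) * qStar n ^ (n - 2) := by
  unfold alpha qStar; ring

theorem secondDensity_qStar {n : ℕ} (hn : 3 ≤ n) : secondDensity n (qStar n) = 1 + alpha n := by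
  have : (3 : ℝ) ≤ n := by exact_mod_cast hn
  have h0 : ((n : ℝ) - 1) ≠ 0 := by linarith
  rw [one_add_alpha, secondDensity, one_sub_qStar]
  field_simp

/-- Together with `secondDensity_qStar`: the line through the origin of slope `1 + alpha n` touches
`secondCDF` at `qStar n` and is tangent there. -/
theorem secondCDF_qStar {n : ℕ} (hn : 3 ≤ n) :
    secondCDF n (qStar n) = (1 + alpha n) * qStar n := by
  have : (3 : ℝ) ≤ n := by exact_mod_cast hn
  have h0 : ((n : ℝ) - 1) ≠ 0 := by linarith
  have hq := qStar_mul hn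
  rw [one_add_alpha, secondCDF]
  obtain ⟨k, rfl⟩ : ∃ k, n = k + 2 := ⟨n - 2, by omega⟩
  have e1 : k + 2 - 1 = k + 1 := by omega
  have e2 : k + 2 - 2 = k := by omega
  rw [e1, e2]
  push_cast at *
  set q := qStar (k + 2)
  have h1 : ((k : ℝ) + 2 - 1) * q = (k + 2) * k / (k + 1) := by
    have : ((k : ℝ) + 1) ≠ 0 := by positivity
    field_simp
    linarith
  have : ((k : ℝ) + 2 - 1) * q ^ (k + 2) = q ^ (k + 1) * ((k + 2) * k / (k + 1)) := by
    rw [← h1]; ring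
  rw [this]
  have : ((k : ℝ) + 1) ≠ 0 := by positivity
  have e3 : (k : ℝ) + 2 - 1 = k + 1 := by ring
  rw [e3]
  field_simp
  ring

/-- The left side does not increase with `j`. It is the ratio of `secondCDF` to its tangent from the
origin, with `j = n - 2` and `s` the argument in units of `qStar n`. -/
theorem pow_mul_le_one (j : ℕ) {s : ℝ} (hs : 0 ≤ s) : s ^ j * (1 + j - j * s) ≤ 1 := by
  induction j with
  | zero => simp
  | succ j ih =>
    have h : s ^ j * (1 + j - j * s) - s ^ (j + 1) * (1 + (j + 1 : ℕ) - (j + 1 : ℕ) * s) =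
        s ^ j * (j + 1) * (1 - s) ^ 2 := by
      push_cast; ring
    have : 0 ≤ s ^ j * (j + 1) * (1 - s) ^ 2 := by positivity
    linarith

theorem secondCDF_le {n : ℕ} (hn : 3 ≤ n) {p : ℝ} (hp : 0 ≤ p) :
    secondCDF n p ≤ (1 + alpha n) * p := by
  have hn' : (3 : ℝ) ≤ n := by exact_mod_cast hn
  have hq := qStar_mul hn
  have hq0 := qStar_pos hn
  rw [one_add_alpha, secondCDF]
  obtain ⟨s, hs⟩ : ∃ s, p = qStar n * s := ⟨p / qStar n, by field_simp⟩
  have hs0 : 0 ≤ s := by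
    rw [hs] at hp
    exact nonneg_of_mul_nonneg_right hp hq0
  have h := pow_mul_le_one (n - 2) hs0
  obtain ⟨k, rfl⟩ : ∃ k, n = k + 2 := ⟨n - 2, by omega⟩
  have e1 : k + 2 - 1 = k + 1 := by omega
  have e2 : k + 2 - 2 = k := by omega
  rw [e2] at h
  rw [e1, e2]
  push_cast at *
  have hk : ((k : ℝ) + 1) ≠ 0 := by positivity
  have e3 : (k : ℝ) + 2 - 1 = k + 1 := by ring
  rw [e3] at *
  have hq1 : qStar (k + 2) = (k + 2) * k / (k + 1) ^ 2 := by
    field_simp; linarith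
  have key : ((k : ℝ) + 2) * p ^ (k + 1) - (k + 1) * p ^ (k + 2) =
      (k + 2) / (k + 1) * qStar (k + 2) ^ k * p * (s ^ k * (1 + k - k * s)) := by
    have : p ^ k = qStar (k + 2) ^ k * s ^ k := by rw [hs, mul_pow]
    rw [pow_succ, pow_add p k 2, this]
    have hp2 : p ^ 2 = p * (((k : ℝ) + 2) * k / (k + 1) ^ 2 * s) := by
      rw [← hq1, ← hs]; ring
    rw [hp2]
    field_simp
    ring
  rw [key]
  have hnn : 0 ≤ ((k : ℝ) + 2) / (k + 1) * qStar (k + 2) ^ k * p := by positivity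
  calc _ ≤ ((k : ℝ) + 2) / (k + 1) * qStar (k + 2) ^ k * p * 1 :=
        mul_le_mul_of_nonneg_left h hnn
    _ = _ := by ring

theorem hasDerivAt_secondCDF {n : ℕ} (hn : 2 ≤ n) (p : ℝ) :
    HasDerivAt (secondCDF n) (secondDensity n p) p := by
  obtain ⟨k, rfl⟩ : ∃ k, n = k + 2 := ⟨n - 2, by omega⟩
  have h := ((hasDerivAt_pow (k + 1) p).const_mul ((k : ℝ) + 2)).sub
    ((hasDerivAt_pow (k + 2) p).const_mul ((k : ℝ) + 1))
  have e1 : k + 2 - 1 = k + 1 := by omega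
  have e2 : k + 2 - 2 = k := by omega
  have hf : secondCDF (k + 2) =
      (fun y => ((k : ℝ) + 2) * y ^ (k + 1)) - fun y => ((k : ℝ) + 1) * y ^ (k + 2) := by
    funext x
    simp only [secondCDF, e1, Pi.sub_apply]
    push_cast
    ring
  rw [hf]
  refine h.congr_deriv ?_
  simp only [secondDensity, e1, e2, Nat.add_sub_cancel]
  push_cast
  ring

theorem continuous_secondDensity (n : ℕ) : Continuous (secondDensity n) := by
  unfold secondDensity; fun_prop

theorem continuous_envelopeDensity (n : ℕ) : Continuous (envelopeDensity n) :=
  (continuous_secondDensity n).comp (continuous_id.max continuous_const)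

theorem continuous_excess (n : ℕ) : Continuous (excess n) :=
  continuous_const.sub (continuous_envelopeDensity n)

theorem antitoneOn_secondDensity {n : ℕ} (hn : 3 ≤ n) :
    AntitoneOn (secondDensity n) (Set.Icc (qStar n) 1) := by
  have hn' : (3 : ℝ) ≤ n := by exact_mod_cast hn
  have hq := qStar_mul hn
  have hq0 := qStar_pos hn
  -- The density peaks at (n - 2)/(n - 1), which lies to the left of `qStar n`.
  have hmode : (n : ℝ) - 2 ≤ (n - 1) * qStar n := by
    have h1 : (n - 1) * ((n : ℝ) - 2) ≤ (n - 1) * ((n - 1) * qStar n) := by nlinarith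
    exact le_of_mul_le_mul_left h1 (by linarith)
  refine antitoneOn_of_deriv_nonpos (convex_Icc _ _) (continuous_secondDensity n).continuousOn
    (by unfold secondDensity; fun_prop) fun u hu => ?_
  rw [interior_Icc] at hu
  obtain ⟨k, rfl⟩ : ∃ k, n = k + 3 := ⟨n - 3, by omega⟩
  have hd : HasDerivAt (secondDensity (k + 3))
      (((k : ℝ) + 3) * (k + 2) * ((k + 1) * u ^ k * (1 - u) - u ^ (k + 1))) u := by
    have h := ((hasDerivAt_pow (k + 1) u).mul ((hasDerivAt_id u).const_sub 1)).const_mul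
      (((k : ℝ) + 3) * (k + 2))
    have hf : secondDensity (k + 3) =
        fun y => ((k : ℝ) + 3) * (k + 2) * ((fun x : ℝ => x ^ (k + 1)) * fun x : ℝ => 1 - id x) y := by
      funext x
      have : k + 3 - 2 = k + 1 := by omega
      simp only [secondDensity, this, Pi.mul_apply, id]
      push_cast
      ring
    rw [hf]
    refine h.congr_deriv ?_
    simp only [Nat.add_sub_cancel, id]
    push_cast
    ring
  rw [hd.deriv]
  have hu0 : 0 < u := hq0.trans hu.1
  have : ((k : ℝ) + 1) * u ^ k * (1 - u) - u ^ (k + 1) = u ^ k * ((k + 1) - (k + 2) * u) := by ring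
  rw [this]
  push_cast at hmode
  have hneg : ((k : ℝ) + 1) - (k + 2) * u ≤ 0 := by
    have : ((k : ℝ) + 2) * qStar (k + 3) ≤ (k + 2) * u :=
      mul_le_mul_of_nonneg_left hu.1.le (by positivity)
    nlinarith
  have : u ^ k * ((k + 1) - (k + 2) * u) ≤ 0 := mul_nonpos_of_nonneg_of_nonpos (by positivity) hneg
  exact mul_nonpos_of_nonneg_of_nonpos (by positivity) this

theorem max_qStar_mem {n : ℕ} (hn : 3 ≤ n) {u : ℝ} (hu : u ≤ 1) :
    max u (qStar n) ∈ Set.Icc (qStar n) 1 :=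
  ⟨le_max_right _ _, max_le hu (qStar_lt_one (by omega)).le⟩

theorem monotoneOn_excess {n : ℕ} (hn : 3 ≤ n) : MonotoneOn (excess n) (Set.Ioo 0 1) := by
  intro u hu v hv huv
  have := antitoneOn_secondDensity hn (max_qStar_mem hn hu.2.le) (max_qStar_mem hn hv.2.le)
    (max_le_max huv le_rfl)
  unfold excess envelopeDensity
  linarith

theorem excess_eq_zero {n : ℕ} (hn : 3 ≤ n) {u : ℝ} (hu : u ≤ qStar n) : excess n u = 0 := by
  rw [excess, envelopeDensity, max_eq_right hu, secondDensity_qStar hn, sub_self]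

theorem excess_nonneg {n : ℕ} (hn : 3 ≤ n) {u : ℝ} (hu : u ≤ 1) : 0 ≤ excess n u := by
  have := antitoneOn_secondDensity hn ⟨le_rfl, (qStar_lt_one (by omega)).le⟩
    (max_qStar_mem hn hu) (le_max_right _ _)
  rw [secondDensity_qStar hn] at this
  unfold excess envelopeDensity
  linarith

theorem envelopeDensity_nonneg {n : ℕ} (hn : 3 ≤ n) {u : ℝ} (hu : u ≤ 1) :
    0 ≤ envelopeDensity n u := by
  have hn' : (3 : ℝ) ≤ n := by exact_mod_cast hn
  obtain ⟨h1, h2⟩ := max_qStar_mem hn hu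
  have h3 : 0 < max u (qStar n) := (qStar_pos hn).trans_le h1
  unfold envelopeDensity secondDensity
  have : 0 ≤ 1 - max u (qStar n) := by linarith
  have : (0 : ℝ) ≤ n - 1 := by linarith
  positivity

theorem excess_le {n : ℕ} (hn : 3 ≤ n) {u : ℝ} (hu : u ≤ 1) : excess n u ≤ 1 + alpha n := by
  have := envelopeDensity_nonneg hn hu
  unfold excess
  linarith

theorem secondCDF_one (n : ℕ) : secondCDF n 1 = 1 := by simp [secondCDF]

theorem integral_envelopeDensity_of_ge {n : ℕ} (hn : 3 ≤ n) {p : ℝ} (hp : qStar n ≤ p)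
    (hp1 : p ≤ 1) : ∫ u in p..1, envelopeDensity n u = 1 - secondCDF n p := by
  have h := intervalIntegral.integral_eq_sub_of_hasDerivAt (a := p) (b := 1)
    (fun u _ => hasDerivAt_secondCDF (n := n) (by omega) u)
    ((continuous_secondDensity n).intervalIntegrable _ _)
  rw [secondCDF_one] at h
  rw [← h]
  refine intervalIntegral.integral_congr fun u hu => ?_
  rw [Set.uIcc_of_le hp1] at hu
  simp only [envelopeDensity, max_eq_left (hp.trans hu.1)]

theorem integral_envelopeDensity_of_le {n : ℕ} (hn : 3 ≤ n) {p : ℝ} (hp : p ≤ qStar n) :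
    ∫ u in p..1, envelopeDensity n u = 1 - (1 + alpha n) * p := by
  have hi : ∀ a b, IntervalIntegrable (envelopeDensity n) volume a b := fun a b =>
    (continuous_envelopeDensity n).intervalIntegrable a b
  rw [← intervalIntegral.integral_add_adjacent_intervals (hi p (qStar n)) (hi _ _),
    integral_envelopeDensity_of_ge hn le_rfl (qStar_lt_one (by omega)).le, secondCDF_qStar hn]
  have : ∫ u in p..qStar n, envelopeDensity n u = ∫ u in p..qStar n, (1 + alpha n) := by
    refine intervalIntegral.integral_congr fun u hu => ?_
    rw [Set.uIcc_of_le hp] at hu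
    simp only [envelopeDensity, max_eq_right hu.2, secondDensity_qStar hn]
  rw [this, intervalIntegral.integral_const, smul_eq_mul]
  ring

/-- The left side is one minus the envelope, and the envelope dominates `secondCDF`. -/
theorem integral_envelopeDensity_le {n : ℕ} (hn : 3 ≤ n) {p : ℝ} (hp0 : 0 ≤ p) (hp1 : p ≤ 1) :
    ∫ u in p..1, envelopeDensity n u ≤ 1 - secondCDF n p := by
  rcases le_total p (qStar n) with h | h
  · rw [integral_envelopeDensity_of_le hn h]
    linarith [secondCDF_le hn hp0]
  · rw [integral_envelopeDensity_of_ge hn h hp1]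

theorem integral_excess_tail {n : ℕ} (hn : 3 ≤ n) :
    ∫ u in qStar n..1, excess n u = alpha n := by
  unfold excess
  rw [intervalIntegral.integral_sub (continuous_const.intervalIntegrable _ _)
    ((continuous_envelopeDensity n).intervalIntegrable _ _),
    integral_envelopeDensity_of_le hn le_rfl, intervalIntegral.integral_const, smul_eq_mul]
  ring

theorem integral_head_eq_zero {n : ℕ} (hn : 3 ≤ n) {f : ℝ → ℝ}
    (hf : ∀ u ≤ qStar n, f u = 0) (hc : Continuous f) :
    ∫ u in (0 : ℝ)..1, f u = ∫ u in qStar n..1, f u := by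
  rw [← intervalIntegral.integral_add_adjacent_intervals
    (hc.intervalIntegrable 0 (qStar n)) (hc.intervalIntegrable _ _)]
  have : ∫ u in (0 : ℝ)..qStar n, f u = ∫ u in (0 : ℝ)..qStar n, (0 : ℝ) := by
    refine intervalIntegral.integral_congr fun u hu => ?_
    rw [Set.uIcc_of_le (qStar_pos hn).le] at hu
    exact hf u hu.2
  rw [this]; simp

theorem integral_excess {n : ℕ} (hn : 3 ≤ n) : ∫ u in (0 : ℝ)..1, excess n u = alpha n := by
  rw [integral_head_eq_zero hn (fun u hu => excess_eq_zero hn hu) (continuous_excess n),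
    integral_excess_tail hn]

theorem integral_excess_sq {n : ℕ} (hn : 3 ≤ n) :
    ∫ u in (0 : ℝ)..1, excess n u ^ 2 = ∫ u in qStar n..1, excess n u ^ 2 :=
  integral_head_eq_zero hn (f := fun u => excess n u ^ 2)
    (fun u hu => by simp [excess_eq_zero hn hu]) ((continuous_excess n).pow 2)

/-! ### Size of `alpha` and `gamma`. -/

/-- Bernoulli's inequality gives the lower bound 1/(n - 1)³. -/
theorem alpha_pos {n : ℕ} (hn : 3 ≤ n) : 0 < alpha n := by
  have hn' : (3 : ℝ) ≤ n := by exact_mod_cast hn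
  obtain ⟨k, rfl⟩ : ∃ k, n = k + 2 := ⟨n - 2, by omega⟩
  push_cast at hn'
  have hk : (1 : ℝ) ≤ k := by linarith
  have e3 : ((k + 2 : ℕ) : ℝ) - 1 = k + 1 := by push_cast; ring
  have hx : -2 ≤ -(1 / ((k : ℝ) + 1) ^ 2) := by
    have : 1 / ((k : ℝ) + 1) ^ 2 ≤ 1 := by
      rw [div_le_one (by positivity)]; nlinarith
    linarith
  have hb := one_add_mul_le_pow hx k
  have hge : ((k : ℝ) + 2) / (k + 1) * (1 + k * -(1 / ((k : ℝ) + 1) ^ 2)) ≤ 1 + alpha (k + 2) := by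
    have : 1 + alpha (k + 2) = ((k : ℝ) + 2) / (k + 1) * (1 + -(1 / ((k : ℝ) + 1) ^ 2)) ^ k := by
      rw [one_add_alpha, qStar, e3]
      simp only [Nat.add_sub_cancel, ← sub_eq_add_neg]
      push_cast
      ring
    rw [this]
    exact mul_le_mul_of_nonneg_left hb (by positivity)
  have hval : ((k : ℝ) + 2) / (k + 1) * (1 + k * -(1 / ((k : ℝ) + 1) ^ 2)) =
      1 + 1 / ((k : ℝ) + 1) ^ 3 := by
    field_simp; ring
  rw [hval] at hge
  have : 0 < 1 / ((k : ℝ) + 1) ^ 3 := by positivity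
  linarith

/-- Cauchy–Schwarz on `[qStar n, 1]`, an interval of length 1/(n - 1)² that carries all of `excess`.
It makes the radicand in `gamma` positive and `alpha` small relative to `gamma`. -/
theorem sq_integral_excess_le {n : ℕ} (hn : 3 ≤ n) :
    ((n : ℝ) - 1) ^ 2 * alpha n ^ 2 ≤ ∫ u in (0 : ℝ)..1, excess n u ^ 2 := by
  have hn' : (3 : ℝ) ≤ n := by exact_mod_cast hn
  have hlt := qStar_lt_one (n := n) (by omega)
  rw [integral_excess_sq hn]
  set K : ℝ := ((n : ℝ) - 1) ^ 2 with hK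
  have hK0 : 0 < K := by
    have : (0 : ℝ) < n - 1 := by linarith
    positivity
  -- `K * alpha n` is the average of `excess` over the interval.
  have h0 : 0 ≤ ∫ u in qStar n..1, (excess n u - K * alpha n) ^ 2 :=
    intervalIntegral.integral_nonneg hlt.le fun u _ => sq_nonneg _
  have h1 : ∫ u in qStar n..1, (excess n u - K * alpha n) ^ 2 =
      (∫ u in qStar n..1, excess n u ^ 2) - 2 * (K * alpha n) * alpha n
        + (1 - qStar n) * (K * alpha n) ^ 2 := by
    have hc := continuous_excess n
    have : ∀ u, (excess n u - K * alpha n) ^ 2 =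
        excess n u ^ 2 - 2 * (K * alpha n) * excess n u + (K * alpha n) ^ 2 := fun u => by ring
    simp only [this]
    rw [intervalIntegral.integral_add, intervalIntegral.integral_sub,
      intervalIntegral.integral_const_mul, integral_excess_tail hn,
      intervalIntegral.integral_const, smul_eq_mul]
    all_goals exact Continuous.intervalIntegrable (by fun_prop) _ _
  rw [h1, one_sub_qStar, ← hK] at h0
  have : 1 / K * (K * alpha n) ^ 2 = K * alpha n ^ 2 := by field_simp
  rw [this] at h0
  nlinarith

/-- `zFun` is `secondDensity` up to the factor -n(n - 1), which cancels in the ratio `phi`. -/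
theorem zFun_sub {n : ℕ} (hn : 3 ≤ n) {y : ℝ} (hy : qStar n ≤ y) :
    zFun n y - zFun n (qStar n) = excess n y / (n * (n - 1)) := by
  have hn' : (3 : ℝ) ≤ n := by exact_mod_cast hn
  have h0 : ((n : ℝ) - 1) ≠ 0 := by linarith
  have h0' : (n : ℝ) ≠ 0 := by linarith
  rw [excess, envelopeDensity, max_eq_left hy, ← secondDensity_qStar hn]
  obtain ⟨k, rfl⟩ : ∃ k, n = k + 2 := ⟨n - 2, by omega⟩
  have e1 : k + 2 - 1 = k + 1 := by omega
  have e2 : k + 2 - 2 = k := by omega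
  simp only [zFun, secondDensity, e1, e2]
  field_simp
  ring

theorem phi_qStar {n : ℕ} (hn : 3 ≤ n) :
    phi n (qStar n) = (∫ u in (0 : ℝ)..1, excess n u ^ 2) / alpha n ^ 2 := by
  have hn' : (3 : ℝ) ≤ n := by exact_mod_cast hn
  have h0 : ((n : ℝ) - 1) ≠ 0 := by linarith
  have h0' : (n : ℝ) ≠ 0 := by linarith
  have hlt := qStar_lt_one (n := n) (by omega)
  have e1 : ∫ y in qStar n..1, (zFun n y - zFun n (qStar n)) = alpha n / (n * (n - 1)) := by
    rw [← integral_excess_tail hn, ← intervalIntegral.integral_div]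
    refine intervalIntegral.integral_congr fun u hu => ?_
    rw [Set.uIcc_of_le hlt.le] at hu
    exact zFun_sub hn hu.1
  have e2 : ∫ y in qStar n..1, (zFun n y - zFun n (qStar n)) ^ 2 =
      (∫ u in (0 : ℝ)..1, excess n u ^ 2) / (n * (n - 1)) ^ 2 := by
    rw [integral_excess_sq hn, ← intervalIntegral.integral_div]
    refine intervalIntegral.integral_congr fun u hu => ?_
    rw [Set.uIcc_of_le hlt.le] at hu
    simp only [zFun_sub hn hu.1, div_pow]
  have := alpha_pos hn
  rw [phi, e1, e2]
  field_simp

/-- The right side is the variance of `excess` under the uniform law. -/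
theorem gamma_sq {n : ℕ} (hn : 3 ≤ n) :
    gamma n ^ 2 = (∫ u in (0 : ℝ)..1, excess n u ^ 2) - alpha n ^ 2 := by
  have hn' : (3 : ℝ) ≤ n := by exact_mod_cast hn
  have h0 : ((n : ℝ) - 1) ≠ 0 := by linarith
  have ha := alpha_pos hn
  have hle := sq_integral_excess_le hn
  have : ((n : ℝ) - 1) ^ 2 * psi n (qStar n) = (∫ u in (0 : ℝ)..1, excess n u ^ 2) / alpha n ^ 2 := by
    rw [psi, one_sub_qStar, phi_qStar hn]
    field_simp
  rw [gamma, this, mul_pow, Real.sq_sqrt]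
  · field_simp
  · rw [sub_nonneg, le_div_iff₀ (by positivity)]
    have : 1 * alpha n ^ 2 ≤ ((n : ℝ) - 1) ^ 2 * alpha n ^ 2 :=
      mul_le_mul_of_nonneg_right (by nlinarith) (by positivity)
    linarith

theorem gamma_nonneg {n : ℕ} (hn : 3 ≤ n) : 0 ≤ gamma n :=
  mul_nonneg (alpha_pos hn).le (Real.sqrt_nonneg _)

theorem mul_alpha_sq_le_gamma_sq {n : ℕ} (hn : 3 ≤ n) :
    (((n : ℝ) - 1) ^ 2 - 1) * alpha n ^ 2 ≤ gamma n ^ 2 := by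
  have := sq_integral_excess_le hn
  rw [gamma_sq hn]
  linarith

theorem gamma_pos {n : ℕ} (hn : 3 ≤ n) : 0 < gamma n := by
  have hn' : (3 : ℝ) ≤ n := by exact_mod_cast hn
  have h := mul_alpha_sq_le_gamma_sq hn
  have ha := alpha_pos hn
  have : 0 < (((n : ℝ) - 1) ^ 2 - 1) * alpha n ^ 2 := mul_pos (by nlinarith) (by positivity)
  exact lt_of_le_of_ne (gamma_nonneg hn) fun h0 => by rw [← h0] at h; linarith

/-- `excess` is at most `1 + alpha n` and lives on an interval of length 1/(n - 1)². -/
theorem gamma_sq_le {n : ℕ} (hn : 3 ≤ n) : gamma n ^ 2 ≤ (1 + alpha n) ^ 2 / ((n : ℝ) - 1) ^ 2 := by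
  have hlt := qStar_lt_one (n := n) (by omega)
  have h : ∫ u in qStar n..1, excess n u ^ 2 ≤ ∫ u in qStar n..1, (1 + alpha n) ^ 2 := by
    refine intervalIntegral.integral_mono_on hlt.le
      (((continuous_excess n).pow 2).intervalIntegrable _ _)
      (continuous_const.intervalIntegrable _ _) fun u hu => ?_
    exact pow_le_pow_left₀ (excess_nonneg hn hu.2) (excess_le hn hu.2) 2
  rw [intervalIntegral.integral_const, smul_eq_mul, one_sub_qStar] at h
  rw [gamma_sq hn, integral_excess_sq hn]
  have : (1 + alpha n) ^ 2 / ((n : ℝ) - 1) ^ 2 = 1 / ((n : ℝ) - 1) ^ 2 * (1 + alpha n) ^ 2 := by ring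
  rw [this]
  nlinarith [sq_nonneg (alpha n)]

/-! ### Limits of `alpha` and `gamma`. -/

/-- This and `le_one_sub_pow` truncate the binomial expansion; the induction step for each order
uses the bound of the preceding order. -/
theorem one_sub_pow_le (N : ℕ) {x : ℝ} (h0 : 0 ≤ x) (h1 : x ≤ 1) :
    (1 - x) ^ N ≤ 1 - N * x + N * (N - 1) / 2 * x ^ 2 := by
  induction N with
  | zero => simp
  | succ N ih =>
    have hb : 1 + (N : ℝ) * -x ≤ (1 + -x) ^ N := one_add_mul_le_pow (by linarith) N
    have : (1 - x) ^ (N + 1) = (1 - x) ^ N - x * (1 - x) ^ N := by ring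
    rw [this]
    have hx := mul_le_mul_of_nonneg_left hb h0
    rw [← sub_eq_add_neg 1 x] at hx
    push_cast
    nlinarith

theorem le_one_sub_pow (N : ℕ) {x : ℝ} (h0 : 0 ≤ x) (h1 : x ≤ 1) :
    1 - N * x + N * (N - 1) / 2 * x ^ 2 - N * (N - 1) * (N - 2) / 6 * x ^ 3 ≤ (1 - x) ^ N := by
  induction N with
  | zero => simp
  | succ N ih =>
    have hx := mul_le_mul_of_nonneg_left (one_sub_pow_le N h0 h1) h0
    have : (1 - x) ^ (N + 1) = (1 - x) ^ N - x * (1 - x) ^ N := by ring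
    rw [this]
    push_cast
    nlinarith

theorem tendsto_sq_mul_alpha :
    Tendsto (fun n : ℕ => (n : ℝ) ^ 2 * alpha n) atTop (𝓝 (1 / 2)) := by
  have hinv : Tendsto (fun k : ℕ => 1 / ((k : ℝ) + 1)) atTop (𝓝 0) :=
    tendsto_one_div_add_atTop_nhds_zero_nat
  -- With y = 1/(n - 1), `A` is n²α computed from the second-order truncation and `B` is the
  -- contribution of the cubic term. The terms up to first order leave only y³ in α.
  let A : ℝ → ℝ := fun y => (1 + y) ^ 2 * (y + (1 + y) * ((1 - y) * (1 - 2 * y) / 2))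
  let B : ℝ → ℝ := fun y => (1 + y) ^ 2 * (1 + y) * ((1 - y) * (1 - 2 * y) * (1 - 3 * y) / 6 * y)
  have hA : Tendsto (fun k : ℕ => A (1 / ((k : ℝ) + 1))) atTop (𝓝 (1 / 2)) := by
    have : Continuous A := by fun_prop
    have h := (this.tendsto 0).comp hinv
    simpa [A, Function.comp_def] using h
  have hB : Tendsto (fun k : ℕ => B (1 / ((k : ℝ) + 1))) atTop (𝓝 0) := by
    have : Continuous B := by fun_prop
    have h := (this.tendsto 0).comp hinv
    simpa [B, Function.comp_def] using h
  rw [← tendsto_add_atTop_iff_nat 2]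
  have hform : ∀ k : ℕ, ((k + 2 : ℕ) : ℝ) ^ 2 * alpha (k + 2) = ((k : ℝ) + 2) ^ 2 *
      (((k : ℝ) + 2) / (k + 1) * (1 - 1 / ((k : ℝ) + 1) ^ 2) ^ k - 1) := by
    intro k
    have e3 : ((k + 2 : ℕ) : ℝ) - 1 = k + 1 := by push_cast; ring
    simp only [alpha, e3, Nat.add_sub_cancel]
    push_cast
    ring
  have hx : ∀ k : ℕ, 0 ≤ 1 / ((k : ℝ) + 1) ^ 2 ∧ 1 / ((k : ℝ) + 1) ^ 2 ≤ 1 := by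
    intro k
    refine ⟨by positivity, ?_⟩
    rw [div_le_one (by positivity)]
    have : (0 : ℝ) ≤ k := by positivity
    nlinarith
  refine tendsto_of_tendsto_of_tendsto_of_le_of_le (by simpa using hA.sub hB) hA
    (fun k => ?_) (fun k => ?_)
  · have h := le_one_sub_pow k (hx k).1 (hx k).2
    have hk : (0 : ℝ) < k + 1 := by positivity
    have h2 := mul_le_mul_of_nonneg_left h (show 0 ≤ ((k : ℝ) + 2) / (k + 1) by positivity)
    have h3 := mul_le_mul_of_nonneg_left (sub_le_sub_right h2 1)
      (show 0 ≤ ((k : ℝ) + 2) ^ 2 by positivity)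
    dsimp only
    rw [hform]
    refine le_trans (le_of_eq ?_) h3
    simp only [A, B]
    field_simp
    ring
  · have h := one_sub_pow_le k (hx k).1 (hx k).2
    have hk : (0 : ℝ) < k + 1 := by positivity
    have h2 := mul_le_mul_of_nonneg_left h (show 0 ≤ ((k : ℝ) + 2) / (k + 1) by positivity)
    have h3 := mul_le_mul_of_nonneg_left (sub_le_sub_right h2 1)
      (show 0 ≤ ((k : ℝ) + 2) ^ 2 by positivity)
    dsimp only
    rw [hform]
    refine le_trans h3 (le_of_eq ?_)
    simp only [A]
    field_simp
    ring

theorem tendsto_alpha : Tendsto alpha atTop (𝓝 0) := by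
  have h : Tendsto (fun n : ℕ => (n : ℝ)⁻¹ ^ 2 * ((n : ℝ) ^ 2 * alpha n)) atTop (𝓝 0) := by
    simpa using (tendsto_inv_atTop_nhds_zero_nat (𝕜 := ℝ)).pow 2 |>.mul tendsto_sq_mul_alpha
  refine h.congr' ?_
  filter_upwards [eventually_gt_atTop 0] with n hn
  have : (n : ℝ) ≠ 0 := by positivity
  field_simp

theorem tendsto_one_div_sub_one : Tendsto (fun n : ℕ => 1 / ((n : ℝ) - 1)) atTop (𝓝 0) := by
  rw [← tendsto_add_atTop_iff_nat 2]
  refine (tendsto_one_div_add_atTop_nhds_zero_nat (𝕜 := ℝ)).congr fun k => ?_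
  push_cast
  ring_nf

theorem tendsto_gamma : Tendsto gamma atTop (𝓝 0) := by
  have h : Tendsto (fun n : ℕ => (1 + alpha n) * (1 / ((n : ℝ) - 1))) atTop (𝓝 0) := by
    simpa using (tendsto_alpha.const_add 1).mul tendsto_one_div_sub_one
  refine squeeze_zero' ?_ ?_ h
  · filter_upwards [eventually_ge_atTop 3] with n hn using gamma_nonneg hn
  · filter_upwards [eventually_ge_atTop 3] with n hn
    have hn' : (3 : ℝ) ≤ n := by exact_mod_cast hn
    have h0 : (0 : ℝ) < n - 1 := by linarith
    have ha := alpha_pos hn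
    refine le_of_sq_le_sq ?_ (by positivity)
    rw [mul_pow, div_pow, one_pow, mul_one_div]
    exact gamma_sq_le hn

/-! ### Quantile functions. -/

/-- The uniform distribution on the unit interval. -/
noncomputable abbrev uniform : Measure ℝ := volume.restrict (Set.Ioo 0 1)

instance : IsProbabilityMeasure uniform := ⟨by simp [uniform]⟩

/-- `Q` is a nondecreasing function on the unit interval that transports the uniform distribution
to `F`. -/
structure IsQuantile (Q : ℝ → ℝ) (F : Measure ℝ) : Prop where
  mono : MonotoneOn Q (Set.Ioo 0 1)
  map_eq : uniform.map Q = F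

theorem ae_mem_uniform : ∀ᵐ u ∂uniform, u ∈ Set.Ioo (0 : ℝ) 1 :=
  ae_restrict_mem measurableSet_Ioo

theorem IsQuantile.aemeasurable {Q : ℝ → ℝ} {F : Measure ℝ} (h : IsQuantile Q F) :
    AEMeasurable Q uniform :=
  aemeasurable_restrict_of_monotoneOn measurableSet_Ioo h.mono

theorem integral_uniform (f : ℝ → ℝ) : ∫ u, f u ∂uniform = ∫ u in (0 : ℝ)..1, f u := by
  rw [intervalIntegral.integral_of_le zero_le_one, integral_Ioc_eq_integral_Ioo]

/-- The generalized inverse of the distribution function; right continuity makes it a Galois adjoint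
(`hgal`), which identifies the image law. -/
theorem exists_isQuantile (F : Measure ℝ) [IsProbabilityMeasure F] : ∃ Q, IsQuantile Q F := by
  let Q : ℝ → ℝ := fun u => sInf {x | u ≤ cdf F x}
  have hne : ∀ u ∈ Set.Ioo (0 : ℝ) 1, {x | u ≤ cdf F x}.Nonempty := fun u hu =>
    ((tendsto_cdf_atTop F).eventually (eventually_ge_nhds hu.2)).exists
  have hbdd : ∀ u ∈ Set.Ioo (0 : ℝ) 1, BddBelow {x | u ≤ cdf F x} := by
    intro u hu
    obtain ⟨b, hb⟩ := ((tendsto_cdf_atBot F).eventually (eventually_lt_nhds hu.1)).exists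
    refine ⟨b, fun x hx => ?_⟩
    by_contra hlt
    exact absurd (hx.trans (monotone_cdf F (not_le.1 hlt).le)) (not_le.2 hb)
  have hgal : ∀ u ∈ Set.Ioo (0 : ℝ) 1, ∀ x, Q u ≤ x ↔ u ≤ cdf F x := by
    intro u hu x
    constructor
    · intro h
      have hright : ∀ y, x < y → u ≤ cdf F y := by
        intro y hy
        obtain ⟨z, hz, hzy⟩ := exists_lt_of_csInf_lt (hne u hu) (h.trans_lt hy)
        exact le_trans hz (monotone_cdf F hzy.le)
      have hcont : Tendsto (cdf F) (𝓝[>] x) (𝓝 (cdf F x)) :=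
        ((cdf F).right_continuous x).mono_left (nhdsWithin_mono _ Set.Ioi_subset_Ici_self)
      exact ge_of_tendsto hcont (eventually_nhdsWithin_of_forall fun y hy => hright y hy)
    · exact fun h => csInf_le (hbdd u hu) h
  have hmono : MonotoneOn Q (Set.Ioo 0 1) := fun u hu v hv huv =>
    csInf_le_csInf (hbdd u hu) (hne v hv) fun x hx => huv.trans hx
  have hae : AEMeasurable Q uniform := aemeasurable_restrict_of_monotoneOn measurableSet_Ioo hmono
  have : IsProbabilityMeasure (uniform.map Q) := Measure.isProbabilityMeasure_map hae
  refine ⟨Q, hmono, Measure.eq_of_cdf _ _ (StieltjesFunction.ext fun x => ?_)⟩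
  rw [cdf_eq_real (uniform.map Q), map_measureReal_apply_of_aemeasurable hae measurableSet_Iic]
  have hset : (Q ⁻¹' Set.Iic x : Set ℝ) =ᵐ[uniform] Set.Iic (cdf F x) := by
    filter_upwards [ae_mem_uniform] with u hu
    exact propext (hgal u hu x)
  rw [measureReal_congr hset, measureReal_restrict_apply measurableSet_Iic]
  -- The unit interval is open, so the level 1 has no right endpoint to include.
  rcases (cdf_le_one F x).lt_or_eq with h1 | h1
  · have : Set.Iic (cdf F x) ∩ Set.Ioo 0 1 = Set.Ioc 0 (cdf F x) := by
      ext u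
      simp only [Set.mem_inter_iff, Set.mem_Iic, Set.mem_Ioo, Set.mem_Ioc]
      constructor
      · rintro ⟨h, h0, -⟩; exact ⟨h0, h⟩
      · rintro ⟨h0, h⟩; exact ⟨h, h0, h.trans_lt h1⟩
    rw [this, Real.volume_real_Ioc_of_le (cdf_nonneg F x), sub_zero]
  · have : Set.Iic (cdf F x) ∩ Set.Ioo 0 1 = Set.Ioo 0 1 :=
      Set.inter_eq_right.2 fun u hu => by rw [h1]; exact hu.2.le
    rw [this, Real.volume_real_Ioo_of_le zero_le_one, h1, sub_zero]

theorem real_uniform_of_subset_of_subset {s : Set ℝ} {u : ℝ} (hu : u ∈ Set.Ioo (0 : ℝ) 1) :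
    (Set.Ioo 0 u ⊆ s → u ≤ uniform.real s) ∧ (s ∩ Set.Ioo 0 1 ⊆ Set.Ioc 0 u → uniform.real s ≤ u) := by
  constructor
  · intro h
    calc u = uniform.real (Set.Ioo 0 u) := by
          rw [measureReal_restrict_apply measurableSet_Ioo,
            Set.inter_eq_left.2 (Set.Ioo_subset_Ioo_right hu.2.le),
            Real.volume_real_Ioo_of_le hu.1.le, sub_zero]
      _ ≤ _ := measureReal_mono h
  · intro h
    rw [measureReal_restrict_apply' measurableSet_Ioo]
    calc _ ≤ volume.real (Set.Ioc 0 u) := measureReal_mono h (by simp)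
      _ = u := by rw [Real.volume_real_Ioc_of_le hu.1.le, sub_zero]

theorem IsQuantile.real_Iic {Q : ℝ → ℝ} {F : Measure ℝ} (h : IsQuantile Q F) (t : ℝ) :
    F.real (Set.Iic t) = uniform.real {u | Q u ≤ t} := by
  rw [← h.map_eq, map_measureReal_apply_of_aemeasurable h.aemeasurable measurableSet_Iic]
  rfl

/-- By monotonicity the superlevel set is an upper interval of the right length; only its endpoint
is undetermined. -/
theorem IsQuantile.lt_ae_eq {Q : ℝ → ℝ} {F : Measure ℝ} (h : IsQuantile Q F) (t : ℝ) :
    {u | t < Q u} =ᵐ[uniform] Set.Ioi (F.real (Set.Iic t)) := by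
  have hne : ∀ᵐ u ∂uniform, u ≠ F.real (Set.Iic t) :=
    ae_restrict_of_ae (by simp [ae_iff])
  filter_upwards [ae_mem_uniform, hne] with u hu hne
  apply propext
  change t < Q u ↔ F.real (Set.Iic t) < u
  constructor
  · intro ht
    refine lt_of_le_of_ne ?_ hne.symm
    rw [h.real_Iic]
    refine (real_uniform_of_subset_of_subset hu).2 fun w hw => ⟨hw.2.1, ?_⟩
    by_contra hlt
    exact absurd (ht.trans_le (h.mono hu hw.2 (not_le.1 hlt).le)) (not_lt.2 hw.1)
  · intro ht
    by_contra hle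
    rw [h.real_Iic] at ht
    refine absurd ((real_uniform_of_subset_of_subset hu).1 fun w hw => ?_) (not_le.2 ht)
    exact (h.mono ⟨hw.1, hw.2.trans hu.2⟩ hu hw.2.le).trans (not_lt.1 hle)

/-- Layer-cake formula for `Q` under the measure with density `envelopeDensity`, with superlevel
sets given by `lt_ae_eq`. The right side is then comparable with `lintegral_secondValue` for each
`t`. -/
theorem IsQuantile.lintegral_envelopeDensity_mul {Q : ℝ → ℝ} {F : Measure ℝ}
    [IsProbabilityMeasure F] (h : IsQuantile Q F) (hQ : ∀ᵐ u ∂uniform, 0 ≤ Q u) {n : ℕ}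
    (hn : 3 ≤ n) :
    ∫⁻ u, ENNReal.ofReal (envelopeDensity n u * Q u) ∂uniform =
      ∫⁻ t in Set.Ioi 0,
        ENNReal.ofReal (∫ u in F.real (Set.Iic t)..1, envelopeDensity n u) := by
  have hm : Measurable fun u => ENNReal.ofReal (envelopeDensity n u) :=
    (continuous_envelopeDensity n).measurable.ennreal_ofReal
  let ν := uniform.withDensity fun u => ENNReal.ofReal (envelopeDensity n u)
  have hac : ν ≪ uniform := withDensity_absolutelyContinuous _ _
  have h1 : ∫⁻ u, ENNReal.ofReal (envelopeDensity n u * Q u) ∂uniform =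
      ∫⁻ u, ENNReal.ofReal (Q u) ∂ν := by
    rw [lintegral_withDensity_eq_lintegral_mul₀ hm.aemeasurable h.aemeasurable.ennreal_ofReal]
    refine lintegral_congr_ae ?_
    filter_upwards [ae_mem_uniform] with u hu
    rw [ENNReal.ofReal_mul (envelopeDensity_nonneg hn hu.2.le)]
    rfl
  rw [h1, lintegral_eq_lintegral_meas_lt ν (hac.ae_le hQ) (h.aemeasurable.mono_ac hac)]
  refine setLIntegral_congr_fun measurableSet_Ioi fun t _ => ?_
  have hp0 : 0 ≤ F.real (Set.Iic t) := measureReal_nonneg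
  have hp1 : F.real (Set.Iic t) ≤ 1 := measureReal_le_one
  have hset : Set.Ioi (F.real (Set.Iic t)) ∩ Set.Ioo 0 1 = Set.Ioo (F.real (Set.Iic t)) 1 := by
    ext u
    simp only [Set.mem_inter_iff, Set.mem_Ioi, Set.mem_Ioo]
    exact ⟨fun hh => ⟨hh.1, hh.2.2⟩, fun hh => ⟨hh.1, hp0.trans_lt hh.1, hh.2⟩⟩
  rw [measure_congr (hac.ae_le (h.lt_ae_eq t)), withDensity_apply _ measurableSet_Ioi,
    Measure.restrict_restrict measurableSet_Ioi, hset,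
    intervalIntegral.integral_of_le hp1, integral_Ioc_eq_integral_Ioo,
    ofReal_integral_eq_lintegral_ofReal]
  · exact ((continuous_envelopeDensity n).integrableOn_Icc (a := F.real (Set.Iic t))
      (b := 1)).mono_set Set.Ioo_subset_Icc_self
  · filter_upwards [ae_restrict_mem measurableSet_Ioo] with u hu
    exact envelopeDensity_nonneg hn hu.2.le

theorem integrable_mul_excess {Q : ℝ → ℝ} (hQ : Integrable Q uniform) {n : ℕ} (hn : 3 ≤ n) :
    Integrable (fun u => Q u * excess n u) uniform := by
  refine hQ.mul_bdd (c := 1 + alpha n) (continuous_excess n).aestronglyMeasurable ?_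
  filter_upwards [ae_mem_uniform] with u hu
  rw [Real.norm_of_nonneg (excess_nonneg hn hu.2.le)]
  exact excess_le hn hu.2.le

theorem ofReal_integral_envelopeDensity_mul {Q : ℝ → ℝ} (hQ : ∀ᵐ u ∂uniform, 0 ≤ Q u)
    (hi : Integrable Q uniform) {n : ℕ} (hn : 3 ≤ n) :
    ENNReal.ofReal ((1 + alpha n) * ∫ u, Q u ∂uniform - ∫ u, Q u * excess n u ∂uniform) =
      ∫⁻ u, ENNReal.ofReal (envelopeDensity n u * Q u) ∂uniform := by
  have he : ∀ u, envelopeDensity n u * Q u = (1 + alpha n) * Q u - Q u * excess n u := fun u => by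
    unfold excess; ring
  have hi' : Integrable (fun u => envelopeDensity n u * Q u) uniform := by
    simp only [he]
    exact (hi.const_mul _).sub (integrable_mul_excess hi hn)
  rw [← ofReal_integral_eq_lintegral_ofReal hi']
  · simp only [he]
    rw [integral_sub (hi.const_mul _) (integrable_mul_excess hi hn), integral_const_mul]
  · filter_upwards [ae_mem_uniform, hQ] with u hu h0
    exact mul_nonneg (envelopeDensity_nonneg hn hu.2.le) h0

/-- A lower bound on the expected second-highest value in terms of a quantile function. -/
theorem IsQuantile.le_lintegral_secondValue {Q : ℝ → ℝ} {F : Measure ℝ}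
    [IsProbabilityMeasure F] (h : IsQuantile Q F) (hQ : ∀ᵐ u ∂uniform, 0 ≤ Q u)
    (hi : Integrable Q uniform) {n : ℕ} (hn : 3 ≤ n) :
    ENNReal.ofReal ((1 + alpha n) * ∫ u, Q u ∂uniform - ∫ u, Q u * excess n u ∂uniform) ≤
      ∫⁻ v, ENNReal.ofReal (secondValue v) ∂(Measure.pi fun _ : Fin n => F) := by
  rw [ofReal_integral_envelopeDensity_mul hQ hi hn, h.lintegral_envelopeDensity_mul hQ hn,
    lintegral_secondValue (by omega)]
  exact lintegral_mono fun t => ENNReal.ofReal_le_ofReal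
    (integral_envelopeDensity_le hn measureReal_nonneg measureReal_le_one)

/-- The bound of `IsQuantile.le_lintegral_secondValue` is attained if the quantile function is
constant on the interval where the concave envelope is linear. -/
theorem IsQuantile.lintegral_secondValue_eq {Q : ℝ → ℝ} {F : Measure ℝ}
    [IsProbabilityMeasure F] (h : IsQuantile Q F) (hQ : ∀ᵐ u ∂uniform, 0 ≤ Q u)
    (hi : Integrable Q uniform) {n : ℕ} (hn : 3 ≤ n) {a : ℝ}
    (ha : ∀ u ∈ Set.Ioo (0 : ℝ) 1, u ≤ qStar n → Q u = a) :
    ∫⁻ v, ENNReal.ofReal (secondValue v) ∂(Measure.pi fun _ : Fin n => F) =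
      ENNReal.ofReal ((1 + alpha n) * ∫ u, Q u ∂uniform - ∫ u, Q u * excess n u ∂uniform) := by
  rw [ofReal_integral_envelopeDensity_mul hQ hi hn, h.lintegral_envelopeDensity_mul hQ hn,
    lintegral_secondValue (by omega)]
  refine lintegral_congr fun t => ?_
  congr 1
  have hq : qStar n ∈ Set.Ioo (0 : ℝ) 1 := ⟨qStar_pos hn, qStar_lt_one (by omega)⟩
  -- For `a ≤ t` the level F(t) is at least `qStar n`, where envelope and `secondCDF` agree;
  -- otherwise it is 0, where both vanish.
  by_cases hta : a ≤ t
  · refine (integral_envelopeDensity_of_ge hn ?_ measureReal_le_one).symm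
    rw [h.real_Iic]
    refine (real_uniform_of_subset_of_subset hq).1 fun u hu => ?_
    change Q u ≤ t
    rw [ha u ⟨hu.1, hu.2.trans hq.2⟩ hu.2.le]
    exact hta
  · have h0 : F.real (Set.Iic t) = 0 := by
      have hae : ∀ᵐ u ∂uniform, ¬ Q u ≤ t := by
        filter_upwards [ae_mem_uniform] with u hu hle
        rcases le_total u (qStar n) with huq | huq
        · exact hta ((ha u hu huq).symm.trans_le hle)
        · exact hta ((ha _ hq le_rfl).symm.trans_le ((h.mono hq hu huq).trans hle))
      rw [h.real_Iic, measureReal_eq_zero_iff]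
      simpa only [not_not] using ae_iff.1 hae
    rw [h0, integral_envelopeDensity_of_le hn hq.1.le]
    obtain ⟨k, rfl⟩ : ∃ k, n = k + 2 := ⟨n - 2, by omega⟩
    have e1 : k + 2 - 1 = k + 1 := by omega
    simp [secondCDF, e1]

/-! ### Expected revenue for the various reserves. -/

/-- The expected second-highest of `n` independent values with distribution `F`. -/
noncomputable def expectedSecond (n : ℕ) (F : Measure ℝ) : ENNReal :=
  ∫⁻ v, ENNReal.ofReal (secondValue v) ∂(Measure.pi fun _ : Fin n => F)

theorem ae_pi_of_ae {n : ℕ} {F : Measure ℝ} [IsProbabilityMeasure F] {P : ℝ → Prop}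
    (h : ∀ᵐ x ∂F, P x) : ∀ᵐ v ∂(Measure.pi fun _ : Fin n => F), ∀ i, P (v i) :=
  ae_all_iff.2 fun _ => Measure.tendsto_eval_ae_ae.eventually h

theorem coe_ofReal_le {x : ENNReal} {y : ℝ} (hy : 0 ≤ y) (h : x ≤ ENNReal.ofReal y) :
    (x : EReal) ≤ (y : EReal) := by
  have := EReal.coe_ennreal_le_coe_ennreal_iff.2 h
  rwa [EReal.coe_ennreal_ofReal, max_eq_left hy] at this

theorem le_coe_of_ofReal_le {x : ENNReal} {y : ℝ} (h : ENNReal.ofReal y ≤ x) :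
    (y : EReal) ≤ (x : EReal) := by
  refine le_trans ?_ (EReal.coe_ennreal_le_coe_ennreal_iff.2 h)
  rw [EReal.coe_ennreal_ofReal]
  exact EReal.coe_le_coe_iff.2 (le_max_left _ _)

theorem expectedSecond_le_expectedRevenue {n : ℕ} (hn : 2 ≤ n) {c : ℝ} (hc : 0 ≤ c)
    (F : ProbabilityMeasure ℝ) :
    (expectedSecond n (F : Measure ℝ) : EReal) ≤ expectedRevenue c F (spaTruthful n c) := by
  rw [expectedRevenue_spaTruthful hn hc hc]
  exact EReal.coe_ennreal_le_coe_ennreal_iff.2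
    (lintegral_mono fun v => ENNReal.ofReal_le_ofReal (secondValue_le_revenue hn hc v))

theorem expectedRevenue_eq_expectedSecond {n : ℕ} (hn : 2 ≤ n) {c r a : ℝ} (hc : 0 ≤ c)
    (hr : 0 ≤ r) (hra : r < a) {F : ProbabilityMeasure ℝ}
    (hF : ∀ᵐ v ∂(F : Measure ℝ), a ≤ v) :
    expectedRevenue c F (spaTruthful n r) = (expectedSecond n (F : Measure ℝ) : EReal) := by
  rw [expectedRevenue_spaTruthful hn hc hr, expectedSecond]
  congr 1
  refine lintegral_congr_ae ?_
  filter_upwards [ae_pi_of_ae hF] with v hv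
  rw [revenue_eq_secondValue hn c hr hra hv]

/-- A sale needs a bid strictly above the reserve, so an atom at `r` does not sell. -/
theorem expectedRevenue_of_le_reserve {n : ℕ} (hn : 2 ≤ n) {c r : ℝ} (hc : 0 ≤ c)
    (hr : 0 ≤ r) {F : ProbabilityMeasure ℝ} (hF : ∀ᵐ v ∂(F : Measure ℝ), v ≤ r) :
    expectedRevenue c F (spaTruthful n r) = (c : EReal) := by
  have : ∫⁻ v, ENNReal.ofReal (revenue c (spaTruthful n r) v)
      ∂(Measure.pi fun _ : Fin n => (F : Measure ℝ)) = ENNReal.ofReal c := by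
    calc _ = ∫⁻ _, ENNReal.ofReal c ∂(Measure.pi fun _ : Fin n => (F : Measure ℝ)) := by
          refine lintegral_congr_ae ?_
          filter_upwards [ae_pi_of_ae hF] with v hv
          rw [revenue_of_unsold c fun ⟨i, hi⟩ => absurd (hv i) (not_le.2 hi)]
      _ = _ := by simp
  rw [expectedRevenue_spaTruthful hn hc hr, this, EReal.coe_ennreal_ofReal, max_eq_left hc]

/-- If the reserve is the smallest possible value, the object is often unsold. -/
theorem expectedRevenue_le_of_reserve_le {n : ℕ} (hn : 2 ≤ n) {c r m h : ℝ} (hc : 0 ≤ c)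
    (hr : 0 ≤ r) (hrm : r ≤ m) (hh : 0 ≤ h) {F : ProbabilityMeasure ℝ}
    (hF : ∀ᵐ v ∂(F : Measure ℝ), r ≤ v)
    (hF' : (F : Measure ℝ) (Set.Ioi r) ≤ ENNReal.ofReal h)
    (hsecond : expectedSecond n (F : Measure ℝ) ≤ ENNReal.ofReal m) :
    expectedRevenue c F (spaTruthful n r) ≤ ((c + (m - r) + m * (n * h) : ℝ) : EReal) := by
  have hm : 0 ≤ m := hr.trans hrm
  let μ := Measure.pi fun _ : Fin n => (F : Measure ℝ)
  let S : Set (Fin n → ℝ) := ⋃ i, {v | r < v i}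
  have hmS : MeasurableSet S := MeasurableSet.iUnion fun i =>
    measurableSet_lt measurable_const (measurable_pi_apply i)
  have hS : μ S ≤ ENNReal.ofReal (n * h) := by
    calc μ S ≤ ∑ i : Fin n, μ {v | r < v i} := measure_iUnion_fintype_le _ _
      _ ≤ ∑ i : Fin n, ENNReal.ofReal h := by
          refine Finset.sum_le_sum fun i _ => ?_
          have := (measurePreserving_eval (fun _ : Fin n => (F : Measure ℝ)) i).measure_preimage
            (measurableSet_Ioi (a := r)).nullMeasurableSet
          exact le_trans (le_of_eq this) hF'
      _ = ENNReal.ofReal (n * h) := by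
          rw [Finset.sum_const, Finset.card_univ, Fintype.card_fin, nsmul_eq_mul,
            ENNReal.ofReal_mul (by positivity), ENNReal.ofReal_natCast]
  -- Adding `r` to both sides avoids truncated subtraction. In a sale, revenue is the second-highest
  -- value; without one it is `c`, and the second-highest value still covers `r`.
  have hpt : ∀ᵐ v ∂μ, ENNReal.ofReal (revenue c (spaTruthful n r) v) + ENNReal.ofReal r ≤
      ENNReal.ofReal c + ENNReal.ofReal (secondValue v) +
        S.indicator (fun _ => ENNReal.ofReal r) v := by
    filter_upwards [ae_pi_of_ae (n := n) hF] with v hv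
    have hs := le_secondValue hn hv
    by_cases hsold : ∃ i, r < v i
    · have hvS : v ∈ S := Set.mem_iUnion.2 hsold
      rw [revenue_of_sold hn c hr hsold, max_eq_right hs, Set.indicator_of_mem hvS]
      gcongr
      exact le_add_self
    · have hvS : v ∉ S := fun hv' => hsold (Set.mem_iUnion.1 hv')
      rw [revenue_of_unsold c hsold, Set.indicator_of_notMem hvS, add_zero]
      gcongr
  have hint := lintegral_mono_ae hpt
  rw [lintegral_add_right _ measurable_const,
    lintegral_add_right _ (measurable_const.indicator hmS),
    lintegral_add_left measurable_const, lintegral_indicator_const hmS] at hint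
  simp only [lintegral_const, measure_univ, mul_one] at hint
  set R := ∫⁻ v, ENNReal.ofReal (revenue c (spaTruthful n r) v) ∂μ with hR
  have h2 : R + ENNReal.ofReal r ≤
      ENNReal.ofReal (c + (m - r) + m * (n * h)) + ENNReal.ofReal r := by
    have hmr : 0 ≤ m - r := by linarith
    have hmn : 0 ≤ m * (n * h) := by positivity
    calc R + ENNReal.ofReal r ≤ _ := hint
      _ ≤ ENNReal.ofReal c + ENNReal.ofReal m + ENNReal.ofReal m * ENNReal.ofReal (n * h) := by
          refine add_le_add (add_le_add_right hsecond _) ?_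
          exact mul_le_mul' (ENNReal.ofReal_le_ofReal hrm) hS
      _ = _ := by
          rw [← ENNReal.ofReal_mul hm, ← ENNReal.ofReal_add hc hm,
            ← ENNReal.ofReal_add (by positivity) hmn, ← ENNReal.ofReal_add (by positivity) hr]
          congr 1
          ring
  rw [expectedRevenue_spaTruthful hn hc hr]
  refine coe_ofReal_le ?_ ((ENNReal.add_le_add_iff_right ENNReal.ofReal_ne_top).1 h2)
  have hmr : 0 ≤ m - r := by linarith
  positivity

theorem guarantee_spa_eq {n : ℕ} {Δ : Set (ProbabilityMeasure ℝ)} {c r : ℝ}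
    {SC : SolutionConcept n} (h : SelectsTruthful Δ SC r) :
    guarantee Δ c SC (spa n r) = reserveGuarantee n Δ c r := by
  unfold guarantee reserveGuarantee
  refine iInf_congr fun F => iInf_congr fun hF => ?_
  rw [h F hF]
  simp

/-! ### The upper bound and the common criterion. -/

/-- The point mass at `m` as a probability measure. -/
noncomputable def pointMass (m : ℝ) : ProbabilityMeasure ℝ := ⟨Measure.dirac m, inferInstance⟩

theorem ae_pointMass (m : ℝ) : ∀ᵐ v ∂(pointMass m : Measure ℝ), v = m := by
  change ∀ᵐ v ∂(Measure.dirac m), v = m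
  simp [ae_dirac_eq]

/-- Only the profile where every value is `m` matters under the point mass; individual rationality
there bounds the payments. -/
theorem guarantee_le_mean {n : ℕ} {V : Set ℝ} {Δ : Set (ProbabilityMeasure ℝ)} {m c : ℝ}
    (hm : 0 < m) (hcm : c < m) (hmV : m ∈ V) (hΔ : pointMass m ∈ Δ)
    (SC : SolutionConcept n) (M : Mechanism n) (hadm : IsAdmissible Δ SC M)
    (hIR : IsRobustlyExPostIR V Δ SC M) : guarantee Δ c SC M ≤ (m : EReal) := by
  obtain ⟨o, ho⟩ := hadm _ hΔ
  refine (iInf₂_le (pointMass m) hΔ).trans ((iInf₂_le o ho).trans ?_)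
  have hrev : revenue c o (fun _ => m) ≤ m := by
    have h1 : ∑ i, o.pay (fun _ => m) i ≤ m * ∑ i, o.alloc (fun _ => m) i := by
      rw [Finset.mul_sum]
      exact Finset.sum_le_sum fun i _ => by
        linarith [hIR _ hΔ o ho (fun _ => m) (fun _ => hmV) i]
    have h2 := (o.alloc_mem fun _ => m).2
    unfold revenue
    nlinarith
  have hle : ∫⁻ v, ENNReal.ofReal (revenue c o v)
      ∂(Measure.pi fun _ : Fin n => (pointMass m : Measure ℝ)) ≤ ENNReal.ofReal m := by
    calc _ ≤ ∫⁻ _, ENNReal.ofReal m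
          ∂(Measure.pi fun _ : Fin n => (pointMass m : Measure ℝ)) := by
          refine lintegral_mono_ae ?_
          filter_upwards [ae_pi_of_ae (ae_pointMass m)] with v hv
          rw [funext hv]
          exact ENNReal.ofReal_le_ofReal hrev
      _ = _ := by simp
  unfold expectedRevenue
  -- The negative part can only lower revenue, so bounding the positive part suffices.
  refine (EReal.sub_le_sub le_rfl (EReal.coe_ennreal_nonneg _)).trans ?_
  rw [sub_zero]
  exact coe_ofReal_le hm.le hle

/-- Sufficient conditions for the second-price auction to be asymptotically maxmin: a lower bound
on the expected second-highest value, distributions that attain it with values above `a n`, and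
distributions with a large atom at any reserve between `a n` and the mean. -/
theorem asymptoticallyMaxmin_of_bounds {V : Set ℝ} {Δ : Set (ProbabilityMeasure ℝ)} {m c : ℝ}
    {π a : ℕ → ℝ} (hm : 0 < m) (hc : 0 ≤ c) (hcm : c < m) (hmV : m ∈ V) (hΔ : pointMass m ∈ Δ)
    (hlow : ∀ n, 3 ≤ n → ∀ F ∈ Δ, ENNReal.ofReal (m - π n) ≤ expectedSecond n (F : Measure ℝ))
    (ha : Tendsto a atTop (𝓝 m))
    (hworst : ∀ᶠ n in atTop, ∃ F ∈ Δ, (∀ᵐ v ∂(F : Measure ℝ), a n ≤ v) ∧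
      expectedSecond n (F : Measure ℝ) ≤ ENNReal.ofReal (m - π n))
    (hatom : ∀ᶠ n in atTop, ∀ r, 0 ≤ r → a n ≤ r → r < m → ∃ F ∈ Δ,
      (∀ᵐ v ∂(F : Measure ℝ), r ≤ v) ∧
      (F : Measure ℝ) (Set.Ioi r) ≤ ENNReal.ofReal (1 / ((n : ℝ) - 1) ^ 2) ∧
      expectedSecond n (F : Measure ℝ) ≤ ENNReal.ofReal m)
    (hπ : Tendsto π atTop (𝓝 0)) : AsymptoticallyMaxmin V Δ m c π := by
  have hvanish : Tendsto (fun n : ℕ => m * ((n : ℝ) * (1 / ((n : ℝ) - 1) ^ 2))) atTop (𝓝 0) := by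
    have h1 := tendsto_one_div_sub_one
    have h2 : Tendsto (fun n : ℕ => m * (1 / ((n : ℝ) - 1) + (1 / ((n : ℝ) - 1)) ^ 2)) atTop
        (𝓝 0) := by
      simpa using (h1.add (h1.pow 2)).const_mul m
    refine h2.congr' ?_
    filter_upwards [eventually_ge_atTop 3] with n hn
    have hn' : (3 : ℝ) ≤ n := by exact_mod_cast hn
    have h0 : (n : ℝ) - 1 ≠ 0 := by linarith
    field_simp
    ring
  -- The left side bounds the revenue from a reserve in [a n, m) at its atom law; it tends to `c`,
  -- the right side to `m`.
  have hbound : ∀ᶠ n : ℕ in atTop,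
      c + (m - a n) + m * ((n : ℝ) * (1 / ((n : ℝ) - 1) ^ 2)) < m - π n := by
    have h1 : Tendsto (fun n : ℕ => c + (m - a n) + m * ((n : ℝ) * (1 / ((n : ℝ) - 1) ^ 2)))
        atTop (𝓝 c) := by
      simpa using ((ha.const_sub m).const_add c).add hvanish
    have h2 : Tendsto (fun n => m - π n) atTop (𝓝 m) := by simpa using hπ.const_sub m
    exact h1.eventually_lt h2 hcm
  have hbound' : ∀ᶠ n : ℕ in atTop, c < m - π n := by
    have h2 : Tendsto (fun n => m - π n) atTop (𝓝 m) := by simpa using hπ.const_sub m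
    exact h2.eventually (eventually_gt_nhds hcm)
  have hvalue : ∀ᶠ n in atTop, (((m - π n : ℝ) : EReal) ≤ reserveGuarantee n Δ c c) ∧
      ∀ r, 0 ≤ r → reserveGuarantee n Δ c r ≤ ((m - π n : ℝ) : EReal) := by
    filter_upwards [hworst, hatom, hbound, hbound', eventually_ge_atTop 3]
      with n hw hat hb hb' hn
    have hn2 : 2 ≤ n := by omega
    have hpos : 0 ≤ m - π n := hc.trans hb'.le
    refine ⟨le_iInf₂ fun F hF => ?_, fun r hr => ?_⟩
    · exact (le_coe_of_ofReal_le (hlow n hn F hF)).trans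
        (expectedSecond_le_expectedRevenue hn2 hc F)
    -- Three ranges of reserves, each with its own bad law: the worst-case law below `a n`, the atom
    -- law up to `m`, the point mass from `m` on.
    · rcases lt_or_ge r (a n) with hra | hra
      · obtain ⟨F, hF, hFa, hFs⟩ := hw
        refine (iInf₂_le F hF).trans ?_
        rw [expectedRevenue_eq_expectedSecond hn2 hc hr hra hFa]
        exact coe_ofReal_le hpos hFs
      · rcases lt_or_ge r m with hrm | hrm
        · obtain ⟨F, hF, hFr, hFI, hFs⟩ := hat r hr hra hrm
          refine (iInf₂_le F hF).trans ((expectedRevenue_le_of_reserve_le hn2 hc hr hrm.le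
            (by positivity) hFr hFI hFs).trans (EReal.coe_le_coe_iff.2 ?_))
          linarith
        · refine (iInf₂_le (pointMass m) hΔ).trans ?_
          rw [expectedRevenue_of_le_reserve hn2 hc hr
            ((ae_pointMass m).mono fun v hv => hv.trans_le hrm)]
          exact EReal.coe_le_coe_iff.2 hb'.le
  have heq : ∀ n, (((m - π n : ℝ) : EReal) ≤ reserveGuarantee n Δ c c) →
      (∀ r, 0 ≤ r → reserveGuarantee n Δ c r ≤ ((m - π n : ℝ) : EReal)) →
      ∀ (SC : SolutionConcept n) (r : ℝ), IsMaxminReserve n Δ c r → SelectsTruthful Δ SC r →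
        guarantee Δ c SC (spa n r) = ((m - π n : ℝ) : EReal) := by
    intro n h1 h2 SC r hr hSC
    rw [guarantee_spa_eq hSC]
    exact le_antisymm (h2 r hr.1) (h1.trans (hr.2 c hc))
  refine ⟨fun n _ SC M hadm hIR => guarantee_le_mean hm hcm hmV hΔ SC M hadm hIR, ?_, ?_⟩
  · obtain ⟨N, hN⟩ := eventually_atTop.1 hvalue
    refine ⟨N, fun n hn => ?_⟩
    obtain ⟨h1, h2⟩ := hN n hn.le
    exact ⟨⟨hc, fun r hr => (h2 r hr).trans h1⟩, heq n h1 h2⟩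
  · intro ε hε
    obtain ⟨N, hN⟩ := eventually_atTop.1 (hvalue.and (hπ.eventually (eventually_lt_nhds hε)))
    refine ⟨N, fun n hn SC r hr hSC M hadm hIR => ?_⟩
    obtain ⟨⟨h1, h2⟩, h3⟩ := hN n hn.le
    rw [heq n h1 h2 SC r hr hSC]
    calc guarantee Δ c SC M - (ε : EReal) ≤ (m : EReal) - (ε : EReal) :=
          EReal.sub_le_sub (guarantee_le_mean hm hcm hmV hΔ SC M hadm hIR) le_rfl
      _ = ((m - ε : ℝ) : EReal) := (EReal.coe_sub m ε).symm
      _ < ((m - π n : ℝ) : EReal) := EReal.coe_lt_coe_iff.2 (by linarith)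

/-! ### Laws built from quantile functions; two-point laws. -/

/-- The distribution with quantile function `Q`. -/
noncomputable def quantileLaw (Q : ℝ → ℝ) (hQ : MonotoneOn Q (Set.Ioo 0 1)) :
    ProbabilityMeasure ℝ :=
  ⟨uniform.map Q,
    Measure.isProbabilityMeasure_map (aemeasurable_restrict_of_monotoneOn measurableSet_Ioo hQ)⟩

theorem isQuantile_quantileLaw {Q : ℝ → ℝ} (hQ : MonotoneOn Q (Set.Ioo 0 1)) :
    IsQuantile Q (quantileLaw Q hQ : Measure ℝ) :=
  ⟨hQ, rfl⟩

theorem IsQuantile.ae_iff {Q : ℝ → ℝ} {F : Measure ℝ} (h : IsQuantile Q F) {s : Set ℝ}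
    (hs : MeasurableSet s) : (∀ᵐ v ∂F, v ∈ s) ↔ ∀ᵐ u ∂uniform, Q u ∈ s := by
  rw [← h.map_eq]
  exact ae_map_iff h.aemeasurable hs

theorem IsQuantile.integral_eq {Q : ℝ → ℝ} {F : Measure ℝ} (h : IsQuantile Q F) :
    ∫ v, v ∂F = ∫ u, Q u ∂uniform := by
  rw [← h.map_eq]
  exact integral_map h.aemeasurable aestronglyMeasurable_id

theorem IsQuantile.integrable_iff {Q : ℝ → ℝ} {F : Measure ℝ} (h : IsQuantile Q F) :
    Integrable (fun v : ℝ => v) F ↔ Integrable Q uniform := by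
  rw [← h.map_eq]
  exact integrable_map_measure aestronglyMeasurable_id h.aemeasurable

theorem IsQuantile.evariance_eq {Q : ℝ → ℝ} {F : Measure ℝ} (h : IsQuantile Q F) {m : ℝ}
    (hm : ∫ v, v ∂F = m) :
    evariance (fun v : ℝ => v) F = ∫⁻ u, ENNReal.ofReal ((Q u - m) ^ 2) ∂uniform := by
  rw [evariance_eq_lintegral_ofReal, hm, ← h.map_eq]
  exact lintegral_map' (by fun_prop) h.aemeasurable

theorem expectedSecond_quantileLaw {Q : ℝ → ℝ} (hmono : MonotoneOn Q (Set.Ioo 0 1))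
    (hQ : ∀ u ∈ Set.Ioo (0 : ℝ) 1, 0 ≤ Q u) (hi : Integrable Q uniform) {n : ℕ} (hn : 3 ≤ n)
    {a : ℝ} (ha : ∀ u ∈ Set.Ioo (0 : ℝ) 1, u ≤ qStar n → Q u = a) :
    expectedSecond n (quantileLaw Q hmono : Measure ℝ) =
      ENNReal.ofReal ((1 + alpha n) * ∫ u, Q u ∂uniform - ∫ u, Q u * excess n u ∂uniform) :=
  (isQuantile_quantileLaw hmono).lintegral_secondValue_eq (ae_mem_uniform.mono hQ) hi hn ha

theorem integrable_uniform_of_continuous {f : ℝ → ℝ} (hf : Continuous f) :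
    Integrable f uniform :=
  (hf.integrableOn_Icc (a := 0) (b := 1)).mono_set Set.Ioo_subset_Icc_self

theorem integral_uniform_piecewise {f A B : ℝ → ℝ} {q : ℝ} (hq0 : 0 ≤ q) (hq1 : q < 1)
    (hA : Continuous A) (hB : Continuous B) (hfA : ∀ u ≤ q, f u = A u)
    (hfB : ∀ u, q < u → f u = B u) :
    Integrable f uniform ∧
      ∫ u, f u ∂uniform = (∫ u in (0 : ℝ)..q, A u) + ∫ u in q..1, B u := by
  classical
  have hf : f = (Set.Iic q).piecewise A B := by
    funext u
    by_cases h : u ≤ q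
    · rw [Set.piecewise_eq_of_mem _ _ _ (Set.mem_Iic.2 h), hfA u h]
    · rw [Set.piecewise_eq_of_notMem _ _ _ (by simpa using h), hfB u (not_le.1 h)]
  have h1 := (integrable_uniform_of_continuous hA).integrableOn (s := Set.Iic q)
  have h2 := (integrable_uniform_of_continuous hB).integrableOn (s := (Set.Iic q)ᶜ)
  rw [hf]
  refine ⟨Integrable.piecewise measurableSet_Iic h1 h2, ?_⟩
  have e1 : Set.Iic q ∩ Set.Ioo 0 1 = Set.Ioc 0 q := by
    ext u
    simp only [Set.mem_inter_iff, Set.mem_Iic, Set.mem_Ioo, Set.mem_Ioc]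
    exact ⟨fun h => ⟨h.2.1, h.1⟩, fun h => ⟨h.2, h.1, h.2.trans_lt hq1⟩⟩
  have e2 : Set.Ioi q ∩ Set.Ioo 0 1 = Set.Ioo q 1 := by
    ext u
    simp only [Set.mem_inter_iff, Set.mem_Ioi, Set.mem_Ioo]
    exact ⟨fun h => ⟨h.1, h.2.2⟩, fun h => ⟨h.1, hq0.trans_lt h.1, h.2⟩⟩
  rw [integral_piecewise measurableSet_Iic h1 h2, Set.compl_Iic,
    Measure.restrict_restrict measurableSet_Iic, Measure.restrict_restrict measurableSet_Ioi,
    e1, e2, intervalIntegral.integral_of_le hq0, intervalIntegral.integral_of_le hq1.le,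
    integral_Ioc_eq_integral_Ioo (x := q)]

/-- The quantile function of the distribution with value `r` with probability `qStar n` and value
`b` otherwise. -/
noncomputable def twoPoint (n : ℕ) (r b u : ℝ) : ℝ := if u ≤ qStar n then r else b

section twoPoint

variable {n : ℕ} {r b : ℝ}

theorem twoPoint_of_le {u : ℝ} (h : u ≤ qStar n) : twoPoint n r b u = r := if_pos h

theorem twoPoint_of_lt {u : ℝ} (h : qStar n < u) : twoPoint n r b u = b := if_neg (not_le.2 h)

theorem monotoneOn_twoPoint (hrb : r ≤ b) : MonotoneOn (twoPoint n r b) (Set.Ioo 0 1) := by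
  intro u _ v _ huv
  unfold twoPoint
  split_ifs with h1 h2
  exacts [le_rfl, hrb, absurd (huv.trans ‹_›) h1, le_rfl]

theorem twoPoint_mem_Icc (hrb : r ≤ b) (u : ℝ) : twoPoint n r b u ∈ Set.Icc r b := by
  unfold twoPoint
  split_ifs
  exacts [⟨le_rfl, hrb⟩, ⟨hrb, le_rfl⟩]

theorem integral_twoPoint (hn : 3 ≤ n) :
    Integrable (twoPoint n r b) uniform ∧
      ∫ u, twoPoint n r b u ∂uniform = qStar n * r + (1 - qStar n) * b := by
  have h := integral_uniform_piecewise (f := twoPoint n r b) (A := fun _ => r) (B := fun _ => b)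
    (qStar_pos hn).le (qStar_lt_one (n := n) (by omega)) continuous_const continuous_const
    (fun u hu => twoPoint_of_le hu) (fun u hu => twoPoint_of_lt hu)
  simpa using h

theorem integral_twoPoint_mul_excess (hn : 3 ≤ n) :
    ∫ u, twoPoint n r b u * excess n u ∂uniform = b * alpha n := by
  have h := integral_uniform_piecewise (f := fun u => twoPoint n r b u * excess n u)
    (A := fun _ => 0) (B := fun u => b * excess n u)
    (qStar_pos hn).le (qStar_lt_one (n := n) (by omega)) continuous_const
    ((continuous_excess n).const_mul b)
    (fun u hu => by simp [excess_eq_zero hn hu]) (fun u hu => by simp [twoPoint_of_lt hu])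
  rw [h.2, intervalIntegral.integral_const_mul, integral_excess_tail hn]
  simp

theorem integral_twoPoint_sub_sq (hn : 3 ≤ n) (m : ℝ) :
    Integrable (fun u => (twoPoint n r b u - m) ^ 2) uniform ∧
      ∫ u, (twoPoint n r b u - m) ^ 2 ∂uniform =
        qStar n * (r - m) ^ 2 + (1 - qStar n) * (b - m) ^ 2 := by
  have h := integral_uniform_piecewise (f := fun u => (twoPoint n r b u - m) ^ 2)
    (A := fun _ => (r - m) ^ 2) (B := fun _ => (b - m) ^ 2)
    (qStar_pos hn).le (qStar_lt_one (n := n) (by omega)) continuous_const continuous_const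
    (fun u hu => by simp [twoPoint_of_le hu]) (fun u hu => by simp [twoPoint_of_lt hu])
  simpa using h

/-- The distribution with value `r` with probability `qStar n` and value `b` otherwise. -/
noncomputable def twoPointLaw (n : ℕ) {r b : ℝ} (hrb : r ≤ b) : ProbabilityMeasure ℝ :=
  quantileLaw (twoPoint n r b) (monotoneOn_twoPoint hrb)

theorem isQuantile_twoPoint (hrb : r ≤ b) :
    IsQuantile (twoPoint n r b) (twoPointLaw n hrb : Measure ℝ) :=
  isQuantile_quantileLaw _

theorem ae_twoPointLaw (hrb : r ≤ b) :
    ∀ᵐ v ∂(twoPointLaw n hrb : Measure ℝ), v ∈ Set.Icc r b :=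
  ((isQuantile_twoPoint hrb).ae_iff measurableSet_Icc).2
    (ae_of_all _ fun u => twoPoint_mem_Icc hrb u)

theorem expectedSecond_twoPointLaw (hn : 3 ≤ n) (hr : 0 ≤ r) (hrb : r ≤ b) :
    expectedSecond n (twoPointLaw n hrb : Measure ℝ) =
      ENNReal.ofReal ((1 + alpha n) * (qStar n * r + (1 - qStar n) * b) - b * alpha n) := by
  rw [twoPointLaw, expectedSecond_quantileLaw _
    (fun u _ => hr.trans (twoPoint_mem_Icc hrb u).1) (integral_twoPoint hn).1 hn
    (fun u _ hu => twoPoint_of_le hu), (integral_twoPoint hn).2, integral_twoPoint_mul_excess hn]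

theorem twoPointLaw_Ioi_le (hn : 3 ≤ n) (hrb : r ≤ b) :
    (twoPointLaw n hrb : Measure ℝ) (Set.Ioi r) ≤ ENNReal.ofReal (1 / ((n : ℝ) - 1) ^ 2) := by
  have hq : qStar n ∈ Set.Ioo (0 : ℝ) 1 := ⟨qStar_pos hn, qStar_lt_one (by omega)⟩
  have h : qStar n ≤ (twoPointLaw n hrb : Measure ℝ).real (Set.Iic r) := by
    rw [(isQuantile_twoPoint hrb).real_Iic]
    exact (real_uniform_of_subset_of_subset hq).1 fun u hu => (twoPoint_of_le hu.2.le).le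
  rw [← ofReal_measureReal, ← one_sub_qStar, ← Set.compl_Iic,
    probReal_compl_eq_one_sub measurableSet_Iic]
  exact ENNReal.ofReal_le_ofReal (by linarith)

end twoPoint

theorem tendsto_qStar : Tendsto qStar atTop (𝓝 1) := by
  have h := (tendsto_one_div_sub_one.pow 2).const_sub 1
  rw [zero_pow two_ne_zero, sub_zero] at h
  refine h.congr fun n => ?_
  simp [qStar]

theorem integral_pointMass (m : ℝ) : ∫ v, v ∂(pointMass m : Measure ℝ) = m := by
  change ∫ v, v ∂(Measure.dirac m) = m
  simp

/-- Gives the upper value that a two-point law with lower value `r` needs in order to have mean `m`.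
-/
theorem qStar_mul_add {n : ℕ} (hn : 3 ≤ n) {m r : ℝ} :
    qStar n * r + (1 - qStar n) * (r + (m - r) * ((n : ℝ) - 1) ^ 2) = m := by
  have hn' : (3 : ℝ) ≤ n := by exact_mod_cast hn
  have h0 : (n : ℝ) - 1 ≠ 0 := by linarith
  unfold qStar
  field_simp
  ring

/-! ### Setting (1): known mean and bounded values. -/

/-- The asymptotic optimality of second-price auctions when the mean and an upper bound on the
values are known. -/
theorem asymptoticallyMaxmin_meanBoundSet {m c vbar : ℝ} (hm : 0 < m) (hc : 0 ≤ c) (hcm : c < m)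
    (hv : m < vbar) :
    AsymptoticallyMaxmin (Set.Icc 0 vbar) (meanBoundSet m vbar) m c
      (fun n => alpha n * (vbar - m)) := by
  -- The lower value of the two-point law with upper value `vbar` and mean `m`.
  have ha : Tendsto (fun n => (m - (1 - qStar n) * vbar) / qStar n) atTop (𝓝 m) := by
    have h := (((tendsto_qStar.const_sub 1).mul_const vbar).const_sub m).div tendsto_qStar
      one_ne_zero
    simpa [Pi.div_def] using h
  refine asymptoticallyMaxmin_of_bounds hm hc hcm ⟨hm.le, hv.le⟩ ?_ ?_ ha ?_ ?_ ?_
  · refine ⟨(ae_pointMass m).mono ?_, integral_pointMass m⟩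
    rintro v rfl
    exact ⟨hm.le, hv.le⟩
  · rintro n hn F ⟨hF, hFm⟩
    obtain ⟨Q, hQ⟩ := exists_isQuantile (F : Measure ℝ)
    have hQae := (hQ.ae_iff measurableSet_Icc).1 hF
    have hi : Integrable Q uniform := Integrable.of_mem_Icc 0 vbar hQ.aemeasurable hQae
    refine le_trans (ENNReal.ofReal_le_ofReal ?_)
      (hQ.le_lintegral_secondValue (hQae.mono fun u hu => hu.1) hi hn)
    have h1 : ∫ u, Q u * excess n u ∂uniform ≤ ∫ u, vbar * excess n u ∂uniform := by
      refine integral_mono_ae (integrable_mul_excess hi hn)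
        ((integrable_uniform_of_continuous (continuous_excess n)).const_mul _) ?_
      filter_upwards [ae_mem_uniform, hQae] with u hu hq
      exact mul_le_mul_of_nonneg_right hq.2 (excess_nonneg hn hu.2.le)
    rw [integral_const_mul, integral_uniform (excess n), integral_excess hn] at h1
    rw [← hQ.integral_eq, hFm]
    linarith
  · filter_upwards [ha.eventually (eventually_gt_nhds hm), ha.eventually (eventually_lt_nhds hv),
      eventually_ge_atTop 3] with n h0 h1 hn
    set a := (m - (1 - qStar n) * vbar) / qStar n with hadef
    have hq := qStar_pos hn
    have hmean : qStar n * a + (1 - qStar n) * vbar = m := by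
      rw [hadef]; field_simp; ring
    refine ⟨twoPointLaw n h1.le, ⟨?_, ?_⟩, ?_, ?_⟩
    · exact (ae_twoPointLaw h1.le).mono fun v hv => ⟨h0.le.trans hv.1, hv.2⟩
    · rw [(isQuantile_twoPoint h1.le).integral_eq, (integral_twoPoint hn).2, hmean]
    · exact (ae_twoPointLaw h1.le).mono fun v hv => hv.1
    · rw [expectedSecond_twoPointLaw hn h0.le, hmean]
      exact ENNReal.ofReal_le_ofReal (by linarith)
  · filter_upwards [eventually_ge_atTop 3] with n hn r hr0 har hrm
    have hn' : (3 : ℝ) ≤ n := by exact_mod_cast hn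
    have hq := qStar_pos hn
    have hq1 : 0 < 1 - qStar n := sub_pos.2 (qStar_lt_one (by omega))
    have hmean := qStar_mul_add hn (m := m) (r := r)
    have hK : 1 ≤ ((n : ℝ) - 1) ^ 2 := by nlinarith
    set b := r + (m - r) * ((n : ℝ) - 1) ^ 2 with hb
    have hmb : m ≤ b := by nlinarith
    have hrb : r ≤ b := hrm.le.trans hmb
    -- This is where `r` must be at least the lower value of the worst-case law: raising the lower
    -- value lowers `b`.
    have hbv : b ≤ vbar := by
      rw [div_le_iff₀ hq] at har
      refine le_of_mul_le_mul_left ?_ hq1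
      linarith
    refine ⟨twoPointLaw n hrb, ⟨?_, ?_⟩, ?_, twoPointLaw_Ioi_le hn hrb, ?_⟩
    · exact (ae_twoPointLaw hrb).mono fun v hv => ⟨hr0.trans hv.1, hv.2.trans hbv⟩
    · rw [(isQuantile_twoPoint hrb).integral_eq, (integral_twoPoint hn).2, hmean]
    · exact (ae_twoPointLaw hrb).mono fun v hv => hv.1
    · rw [expectedSecond_twoPointLaw hn hr0, hmean]
      have := mul_le_mul_of_nonneg_right hmb (alpha_pos hn).le
      exact ENNReal.ofReal_le_ofReal (by linarith)
  · simpa using tendsto_alpha.mul_const (vbar - m)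

/-! ### Setting (2): known mean and bounded variance. -/

theorem pointMass_mem_meanVarianceSet {m : ℝ} (hm : 0 < m) (σ : ℝ) :
    pointMass m ∈ meanVarianceSet m σ := by
  refine ⟨(ae_pointMass m).mono ?_, ?_, integral_pointMass m, ?_⟩
  · rintro v rfl
    exact hm.le
  · exact (integrable_const m).congr ((ae_pointMass m).mono fun v hv => hv.symm)
  · rw [evariance_eq_lintegral_ofReal, integral_pointMass]
    change ∫⁻ v, ENNReal.ofReal ((v - m) ^ 2) ∂(Measure.dirac m) ≤ _
    simp

theorem quantileLaw_mem_meanVarianceSet {Q : ℝ → ℝ} (hmono : MonotoneOn Q (Set.Ioo 0 1))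
    (hQ : ∀ u ∈ Set.Ioo (0 : ℝ) 1, 0 ≤ Q u) (hi : Integrable Q uniform) {m σ : ℝ}
    (hm : ∫ u, Q u ∂uniform = m) (hi2 : Integrable (fun u => (Q u - m) ^ 2) uniform)
    (hσ : ∫ u, (Q u - m) ^ 2 ∂uniform ≤ σ ^ 2) :
    quantileLaw Q hmono ∈ meanVarianceSet m σ := by
  have h := isQuantile_quantileLaw hmono
  have hmean : ∫ v, v ∂(quantileLaw Q hmono : Measure ℝ) = m := by rw [h.integral_eq, hm]
  refine ⟨(h.ae_iff measurableSet_Ici).2 (ae_mem_uniform.mono hQ), h.integrable_iff.2 hi, hmean, ?_⟩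
  rw [h.evariance_eq hmean, ← ofReal_integral_eq_lintegral_ofReal hi2
    (ae_of_all _ fun u => sq_nonneg _)]
  exact ENNReal.ofReal_le_ofReal hσ

theorem integral_excess_sub_sq {n : ℕ} (hn : 3 ≤ n) :
    ∫ u, (excess n u - alpha n) ^ 2 ∂uniform = gamma n ^ 2 := by
  have hc := continuous_excess n
  have h : ∀ u, (excess n u - alpha n) ^ 2 =
      excess n u ^ 2 - 2 * alpha n * excess n u + alpha n ^ 2 := fun u => by ring
  rw [gamma_sq hn, integral_uniform]
  simp only [h]
  rw [intervalIntegral.integral_add, intervalIntegral.integral_sub,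
    intervalIntegral.integral_const_mul, integral_excess hn, intervalIntegral.integral_const,
    smul_eq_mul]
  · ring
  all_goals exact Continuous.intervalIntegrable (by fun_prop) _ _

/-- Cauchy–Schwarz for the covariance of `Q` and `excess`, whose standard deviations are at most `σ`
and equal to `gamma n`. -/
theorem integral_mul_excess_le {Q : ℝ → ℝ} (hi : Integrable Q uniform) {m σ : ℝ} (hσ : 0 ≤ σ)
    (hm : ∫ u, Q u ∂uniform = m) (hi2 : Integrable (fun u => (Q u - m) ^ 2) uniform)
    (hvar : ∫ u, (Q u - m) ^ 2 ∂uniform ≤ σ ^ 2) {n : ℕ} (hn : 3 ≤ n) :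
    ∫ u, Q u * excess n u ∂uniform ≤ m * alpha n + σ * gamma n := by
  have hγ := gamma_pos hn
  have hc := continuous_excess n
  have hQe := integrable_mul_excess hi hn
  have hei : Integrable (excess n) uniform := integrable_uniform_of_continuous hc
  have heint : ∫ u, excess n u ∂uniform = alpha n := by rw [integral_uniform, integral_excess hn]
  have hYY : Integrable (fun u => (excess n u - alpha n) ^ 2) uniform :=
    integrable_uniform_of_continuous (by fun_prop)
  have hsplit : ∀ u, (Q u - m) * (excess n u - alpha n) =
      Q u * excess n u - alpha n * Q u - m * excess n u + m * alpha n := fun u => by ring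
  have hXY : Integrable (fun u => (Q u - m) * (excess n u - alpha n)) uniform := by
    simp only [hsplit]
    exact ((hQe.sub (hi.const_mul _)).sub (hei.const_mul _)).add (integrable_const _)
  have hXYint : ∫ u, (Q u - m) * (excess n u - alpha n) ∂uniform =
      ∫ u, Q u * excess n u ∂uniform - m * alpha n := by
    simp only [hsplit]
    rw [integral_add, integral_sub, integral_sub hQe (hi.const_mul _), integral_const_mul,
      integral_const_mul, hm, heint, integral_const, probReal_univ, one_smul]
    · ring
    · exact hQe.sub (hi.const_mul _)
    · exact hei.const_mul _
    · exact (hQe.sub (hi.const_mul _)).sub (hei.const_mul _)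
    · exact integrable_const _
  set I := ∫ u, (Q u - m) * (excess n u - alpha n) ∂uniform with hI
  have hquad : ∀ t : ℝ, 0 ≤ ∫ u, (Q u - m) ^ 2 ∂uniform - 2 * t * I + t ^ 2 * gamma n ^ 2 := by
    intro t
    have h0 : 0 ≤ ∫ u, ((Q u - m) - t * (excess n u - alpha n)) ^ 2 ∂uniform :=
      integral_nonneg fun u => sq_nonneg _
    have h1 : ∀ u, ((Q u - m) - t * (excess n u - alpha n)) ^ 2 = (Q u - m) ^ 2 -
        2 * t * ((Q u - m) * (excess n u - alpha n)) + t ^ 2 * (excess n u - alpha n) ^ 2 :=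
      fun u => by ring
    simp only [h1] at h0
    rw [integral_add, integral_sub hi2 (hXY.const_mul _), integral_const_mul, integral_const_mul,
      integral_excess_sub_sq hn] at h0
    · exact h0
    · exact hi2.sub (hXY.const_mul _)
    · exact hYY.const_mul _
  have hsq : I ^ 2 ≤ (σ * gamma n) ^ 2 := by
    -- The minimizer of the quadratic in `t`.
    have h := hquad (I / gamma n ^ 2)
    have e : (∫ u, (Q u - m) ^ 2 ∂uniform) - 2 * (I / gamma n ^ 2) * I
        + (I / gamma n ^ 2) ^ 2 * gamma n ^ 2 =
        (∫ u, (Q u - m) ^ 2 ∂uniform) - I ^ 2 / gamma n ^ 2 := by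
      field_simp
      ring
    rw [e, sub_nonneg, div_le_iff₀ (by positivity)] at h
    rw [mul_pow]
    exact h.trans (mul_le_mul_of_nonneg_right hvar (by positivity))
  have := abs_le_of_sq_le_sq' hsq (by positivity)
  linarith [this.2]

/-- Needed for the lowest value of the worst-case law, m - σα/γ, to tend to `m`. -/
theorem tendsto_alpha_div_gamma : Tendsto (fun n => alpha n / gamma n) atTop (𝓝 0) := by
  have h : Tendsto (fun n : ℕ => 2 * (1 / ((n : ℝ) - 1))) atTop (𝓝 0) := by
    simpa using tendsto_one_div_sub_one.const_mul 2
  refine squeeze_zero' ?_ ?_ h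
  · filter_upwards [eventually_ge_atTop 3] with n hn
    exact div_nonneg (alpha_pos hn).le (gamma_nonneg hn)
  · filter_upwards [eventually_ge_atTop 3] with n hn
    have hn' : (3 : ℝ) ≤ n := by exact_mod_cast hn
    have ha := alpha_pos hn
    have h1 : (0 : ℝ) < n - 1 := by linarith
    have h2 : ((n : ℝ) - 1) / 2 * alpha n ≤ gamma n := by
      refine le_of_sq_le_sq (le_trans ?_ (mul_alpha_sq_le_gamma_sq hn)) (gamma_nonneg hn)
      rw [mul_pow]
      exact mul_le_mul_of_nonneg_right (by nlinarith) (by positivity)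
    rw [div_le_iff₀ (gamma_pos hn)]
    calc alpha n = 2 * (1 / ((n : ℝ) - 1)) * (((n : ℝ) - 1) / 2 * alpha n) := by field_simp
      _ ≤ _ := mul_le_mul_of_nonneg_left h2 (by positivity)

/-- The asymptotic optimality of second-price auctions when the mean and an upper bound on the
variance are known. -/
theorem asymptoticallyMaxmin_meanVarianceSet {m c σ : ℝ} (hm : 0 < m) (hc : 0 ≤ c) (hcm : c < m)
    (hσ : 0 ≤ σ) :
    AsymptoticallyMaxmin (Set.Ici 0) (meanVarianceSet m σ) m c (fun n => gamma n * σ) := by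
  have ha : Tendsto (fun n => m - σ * (alpha n / gamma n)) atTop (𝓝 m) := by
    simpa using (tendsto_alpha_div_gamma.const_mul σ).const_sub m
  refine asymptoticallyMaxmin_of_bounds hm hc hcm hm.le (pointMass_mem_meanVarianceSet hm σ)
    ?_ ha ?_ ?_ ?_
  · rintro n hn F ⟨hF, hFi, hFm, hFv⟩
    obtain ⟨Q, hQ⟩ := exists_isQuantile (F : Measure ℝ)
    have hQae := (hQ.ae_iff measurableSet_Ici).1 hF
    have hi := hQ.integrable_iff.1 hFi
    have hQm : ∫ u, Q u ∂uniform = m := by rw [← hQ.integral_eq, hFm]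
    rw [hQ.evariance_eq hFm] at hFv
    have hi2 : Integrable (fun u => (Q u - m) ^ 2) uniform := by
      refine ⟨((hQ.aemeasurable.sub_const m).pow_const 2).aestronglyMeasurable, ?_⟩
      rw [hasFiniteIntegral_iff_ofReal (ae_of_all _ fun u => sq_nonneg _)]
      exact hFv.trans_lt ENNReal.ofReal_lt_top
    have hvar : ∫ u, (Q u - m) ^ 2 ∂uniform ≤ σ ^ 2 := by
      rwa [← ofReal_integral_eq_lintegral_ofReal hi2 (ae_of_all _ fun u => sq_nonneg _),
        ENNReal.ofReal_le_ofReal_iff (by positivity)] at hFv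
    refine le_trans (ENNReal.ofReal_le_ofReal ?_) (hQ.le_lintegral_secondValue hQae hi hn)
    have := integral_mul_excess_le hi hσ hQm hi2 hvar hn
    rw [hQm]
    linarith
  · filter_upwards [ha.eventually (eventually_gt_nhds hm), eventually_ge_atTop 3] with n h0 hn
    have hγ := gamma_pos hn
    have hce := continuous_excess n
    set l := σ / gamma n with hl
    have hl0 : 0 ≤ l := div_nonneg hσ hγ.le
    have hlα : σ * (alpha n / gamma n) = l * alpha n := by rw [hl]; ring
    have hlγ : l * gamma n = σ := by rw [hl]; field_simp
    rw [hlα] at h0 ⊢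
    -- The equality case of Cauchy–Schwarz, with `l` scaled to give standard deviation `σ`. `Q`
    -- inherits monotonicity from `excess` and is constant up to `qStar n`.
    let Q : ℝ → ℝ := fun u => m + l * (excess n u - alpha n)
    have hmono : MonotoneOn Q (Set.Ioo 0 1) := fun u hu v hv huv =>
      add_le_add_right (mul_le_mul_of_nonneg_left
        (sub_le_sub_right (monotoneOn_excess hn hu hv huv) _) hl0) m
    have hge : ∀ u ∈ Set.Ioo (0 : ℝ) 1, m - l * alpha n ≤ Q u := by
      intro u hu
      have := mul_nonneg hl0 (excess_nonneg hn hu.2.le)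
      simp only [Q]
      linarith
    have hQc : Continuous Q := by fun_prop
    have hi := integrable_uniform_of_continuous hQc
    have hei : Integrable (excess n) uniform := integrable_uniform_of_continuous hce
    have heint : ∫ u, excess n u ∂uniform = alpha n := by
      rw [integral_uniform, integral_excess hn]
    have hQm : ∫ u, Q u ∂uniform = m := by
      simp only [Q]
      rw [integral_add, integral_const_mul, integral_sub hei (integrable_const _), heint]
      · simp
      · exact integrable_const _
      · exact (hei.sub (integrable_const _)).const_mul _
    have hQsq : ∀ u, (Q u - m) ^ 2 = l ^ 2 * (excess n u - alpha n) ^ 2 := fun u => by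
      simp only [Q]; ring
    have hvar : ∫ u, (Q u - m) ^ 2 ∂uniform = σ ^ 2 := by
      simp only [hQsq]
      rw [integral_const_mul, integral_excess_sub_sq hn, ← hlγ]
      ring
    have hQe : ∫ u, Q u * excess n u ∂uniform = m * alpha n + σ * gamma n := by
      have h : ∀ u, Q u * excess n u = l * (excess n u - alpha n) ^ 2 +
          (m + l * alpha n) * excess n u - l * alpha n ^ 2 := fun u => by
        simp only [Q]; ring
      have hYY : Integrable (fun u => (excess n u - alpha n) ^ 2) uniform :=
        integrable_uniform_of_continuous (by fun_prop)
      simp only [h]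
      rw [integral_sub, integral_add (hYY.const_mul _) (hei.const_mul _), integral_const_mul,
        integral_const_mul, integral_excess_sub_sq hn, heint, ← hlγ, integral_const,
        probReal_univ, one_smul]
      · ring
      · exact (hYY.const_mul _).add (hei.const_mul _)
      · exact integrable_const _
    refine ⟨quantileLaw Q hmono, quantileLaw_mem_meanVarianceSet hmono
      (fun u hu => h0.le.trans (hge u hu)) hi hQm
      (integrable_uniform_of_continuous (by fun_prop)) hvar.le, ?_, ?_⟩
    · exact ((isQuantile_quantileLaw hmono).ae_iff measurableSet_Ici).2 (ae_mem_uniform.mono hge)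
    · rw [expectedSecond_quantileLaw hmono (fun u hu => h0.le.trans (hge u hu)) hi hn
        (a := m - l * alpha n), hQm, hQe]
      · exact ENNReal.ofReal_le_ofReal (by linarith)
      · intro u _ hu
        simp only [Q, excess_eq_zero hn hu]
        ring
  · filter_upwards [eventually_ge_atTop 3] with n hn r hr0 har hrm
    have hn' : (3 : ℝ) ≤ n := by exact_mod_cast hn
    have hγ := gamma_pos hn
    have hα := alpha_pos hn
    have hmean := qStar_mul_add hn (m := m) (r := r)
    have hK : 1 ≤ ((n : ℝ) - 1) ^ 2 := by nlinarith
    have hn1 : (n : ℝ) - 1 ≠ 0 := by linarith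
    -- The variance of the two-point law is ((n - 1)² - 1)(m - r)². Since m - r ≤ σα/γ,
    -- `mul_alpha_sq_le_gamma_sq` keeps it within σ².
    have hvar : qStar n * (r - m) ^ 2 +
        (1 - qStar n) * (r + (m - r) * ((n : ℝ) - 1) ^ 2 - m) ^ 2 ≤ σ ^ 2 := by
      have e : qStar n * (r - m) ^ 2 +
          (1 - qStar n) * (r + (m - r) * ((n : ℝ) - 1) ^ 2 - m) ^ 2 =
          (((n : ℝ) - 1) ^ 2 - 1) * (m - r) ^ 2 := by
        unfold qStar
        field_simp
        ring
      have h1 : (m - r) ^ 2 ≤ (σ * (alpha n / gamma n)) ^ 2 :=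
        pow_le_pow_left₀ (by linarith) (by linarith) 2
      have h2 : (((n : ℝ) - 1) ^ 2 - 1) * (σ * (alpha n / gamma n)) ^ 2 =
          σ ^ 2 * (((((n : ℝ) - 1) ^ 2 - 1) * alpha n ^ 2) / gamma n ^ 2) := by
        field_simp
      have h3 : ((((n : ℝ) - 1) ^ 2 - 1) * alpha n ^ 2) / gamma n ^ 2 ≤ 1 :=
        div_le_one_of_le₀ (mul_alpha_sq_le_gamma_sq hn) (by positivity)
      rw [e]
      calc _ ≤ (((n : ℝ) - 1) ^ 2 - 1) * (σ * (alpha n / gamma n)) ^ 2 :=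
            mul_le_mul_of_nonneg_left h1 (by linarith)
        _ ≤ σ ^ 2 * 1 := by
            rw [h2]
            exact mul_le_mul_of_nonneg_left h3 (by positivity)
        _ = σ ^ 2 := mul_one _
    set b := r + (m - r) * ((n : ℝ) - 1) ^ 2 with hb
    have hmb : m ≤ b := by nlinarith
    have hrb : r ≤ b := hrm.le.trans hmb
    refine ⟨twoPointLaw n hrb, ?_, ?_, twoPointLaw_Ioi_le hn hrb, ?_⟩
    · refine quantileLaw_mem_meanVarianceSet _
        (fun u _ => hr0.trans (twoPoint_mem_Icc hrb u).1) (integral_twoPoint hn).1 ?_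
        (integral_twoPoint_sub_sq hn m).1 ?_
      · rw [(integral_twoPoint hn).2, hmean]
      · rw [(integral_twoPoint_sub_sq hn m).2]
        exact hvar
    · exact (ae_twoPointLaw hrb).mono fun v hv => hv.1
    · rw [expectedSecond_twoPointLaw hn hr0, hmean]
      have := mul_le_mul_of_nonneg_right hmb hα.le
      exact ENNReal.ofReal_le_ofReal (by linarith)
  · simpa using tendsto_gamma.mul_const σ

end RobustAuction

theorem mainTheorem5 (m c : ℝ) (hm : 0 < m) (hc : 0 ≤ c) (hcm : c < m) :
    (∀ vbar : ℝ, m < vbar →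
      RobustAuction.AsymptoticallyMaxmin (Set.Icc 0 vbar) (RobustAuction.meanBoundSet m vbar) m c
        (fun n => RobustAuction.alpha n * (vbar - m))) ∧
    (∀ σ : ℝ, 0 ≤ σ →
      RobustAuction.AsymptoticallyMaxmin (Set.Ici 0) (RobustAuction.meanVarianceSet m σ) m c
        (fun n => RobustAuction.gamma n * σ)) ∧
    Filter.Tendsto RobustAuction.alpha Filter.atTop (nhds 0) ∧
    Filter.Tendsto (fun n : ℕ => (n : ℝ) ^ 2 * RobustAuction.alpha n) Filter.atTop
      (nhds (1 / 2)) ∧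
    Filter.Tendsto RobustAuction.gamma Filter.atTop (nhds 0) :=
  ⟨fun _ hv => RobustAuction.asymptoticallyMaxmin_meanBoundSet hm hc hcm hv,
    fun _ hσ => RobustAuction.asymptoticallyMaxmin_meanVarianceSet hm hc hcm hσ,
    RobustAuction.tendsto_alpha, RobustAuction.tendsto_sq_mul_alpha, RobustAuction.tendsto_gamma⟩
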